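/- Let $\Omega=[0,1]^3$. Let $D,\Sigma_a:\Omega\to\mathbb R_{>0}$ and $\nu\Sigma_f:\Omega\to\mathbb R_{\ge 0}$ be piecewise constant, i.e. each takes finitely many values, each of them on a Lebesgue measurable set (for instance, each is constant on finitely many polyhedral subdomains), and let $D_{\min}$, $\Sigma_{a,\min}$ be the least values of $D$ and $\Sigma_a$; both exist and are positive. Let $H^1_0(\Omega)$ be the closure of $C_c^\infty((0,1)^3)$ in $H^1(\Omega)$, with norm $\|\phi\|_{H^1_0}=\bigl(\int_\Omega|\phi|^2+\int_\Omega|\nabla\phi|^2\bigr)^{1/2}$, and for $\phi,\psi\in H^1_0(\Omega)$ put $$a(\phi,\psi)=\int_\Omega\bigl(D\,\nabla\phi\cdot\nabla\psi+\Sigma_a\,\phi\psi\bigr)\,d\mathbf x,\qquad b(\phi,\psi)=\int_\Omega\nu\Sigma_f\,\phi\psi\,d\mathbf x .$$ For a mesh size $0<h<1$ with $1/h\in\mathbb N$ let $V_0^h$ be the space of all $f\in H^1_0(\Omega)$ whose restriction to each cell $[(p-1)h,ph]\times[(q-1)h,qh]\times[(r-1)h,rh]$, $1\le p,q,r\le 1/h$,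 is the translate of a function in $\mathrm{span}\{1,x,y,z,xy,xz,yz,xyz\}$. Theorem. The eigenvalue problem $a(\phi,\psi)=\lambda\,b(\phi,\psi)$ for all $\psi\in H_0^1(\Omega)$, with its Galerkin discretization on the spaces $V_0^h$, satisfies the Babuška–Osborn conditions with the $h$-independent discrete inf-sup function $\beta(h)=\min(D_{\min},\Sigma_{a,\min})>0$. That is: 1. $a$ is bilinear on $H^1_0(\Omega)\times H^1_0(\Omega)$, and there is $C_a>0$ with $|a(\phi,\psi)|\le C_a\|\phi\|_{H^1_0}\|\psi\|_{H^1_0}$ for all $\phi,\psi\in H^1_0(\Omega)$. 2. There is $\alpha>0$ with $\displaystyle\inf_{\phi\in H^1_0(\Omega),\,\|\phi\|_{H^1_0}=1}\ \sup_{\psi\in H^1_0(\Omega),\,\|\psi\|_{H^1_0}=1}|a(\phi,\psi)|\ge\alpha$. 3. For every nonzero $\psi\in H^1_0(\Omega)$, $\sup_{\phi\in H^1_0(\Omega)}|a(\phi,\psi)|>0$. 4. $b$ is bilinear on $H^1_0(\Omega)\times H^1_0(\Omega)$, and there is $C_b>0$ with $|b(\phi,\psi)|\le C_b\|\phi\|_{L^2(\Omega)}\|\psi\|_{H^1_0}$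 for all $\phi,\psi\in H^1_0(\Omega)$. 5. For every mesh size $h$, $\displaystyle\inf_{\phi\in V_0^h,\,\|\phi\|_{H^1_0}=1}\ \sup_{\psi\in V_0^h,\,\|\psi\|_{H^1_0}=1}|a(\phi,\psi)|\ge\beta(h)$. 6. For every mesh size $h$ and every nonzero $\psi\in V_0^h$, $\sup_{\phi\in V_0^h}|a(\phi,\psi)|>0$. 7. For every $\phi\in H^1_0(\Omega)$, $\displaystyle\lim_{h\to0}\beta(h)^{-1}\inf_{\chi\in V_0^h}\|\phi-\chi\|_{H^1_0}=0$, where $h$ runs through the mesh sizes. -/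

import Mathlib

open MeasureTheory Filter Topology
open scoped ENNReal ContDiff Gradient

namespace NeutronDiffusion

/-- Three-dimensional Euclidean space. -/
abbrev Space : Type := EuclideanSpace ℝ (Fin 3)

/-- The closed unit cube `Ω = [0,1]³`. -/
def cube : Set Space := {x | ∀ i, x i ∈ Set.Icc (0 : ℝ) 1}

/-- The open unit cube `(0,1)³`, on which the weak derivatives are tested. -/
def openCube : Set Space := {x | ∀ i, x i ∈ Set.Ioo (0 : ℝ) 1}

/-- Lebesgue measure on `Ω`. -/
noncomputable abbrev cubeMeasure : Measure Space := volume.restrict cube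

/-! ### The Sobolev spaces `H¹(Ω)` and `H¹₀(Ω)` -/

/-- `φ ∈ C_c^∞((0,1)³)`. -/
structure IsTestFunction (φ : Space → ℝ) : Prop where
  smooth : ContDiff ℝ ∞ φ
  hasCompactSupport : HasCompactSupport φ
  tsupport_subset : tsupport φ ⊆ openCube

/-- Pairs in `L²(Ω) × L²(Ω; ℝ³)`, with the norm `‖(u, g)‖ = (‖u‖² + ‖g‖²)^(1/2)`. -/
abbrev L2Pair : Type :=
  WithLp 2 (Lp ℝ 2 cubeMeasure × Lp Space 2 cubeMeasure)

/-- `g` is the weak gradient of `u` on the open cube: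
`∫ u ∇φ = - ∫ φ g` (an identity of vectors) for every test function `φ`. -/
def IsWeakGradient (u : Space → ℝ) (g : Space → Space) : Prop :=
  ∀ φ : Space → ℝ, IsTestFunction φ →
    ∫ x in cube, u x • (∇ φ) x = - ∫ x in cube, φ x • g x

theorem IsTestFunction.continuous_gradient {φ : Space → ℝ} (hφ : IsTestFunction φ) :
    Continuous (∇ φ) :=
  (InnerProductSpace.toDual ℝ Space).symm.continuous.comp
    (hφ.smooth.continuous_fderiv (by simp))

theorem IsTestFunction.memLp {φ : Space → ℝ} (hφ : IsTestFunction φ) :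
    MemLp φ 2 cubeMeasure :=
  (hφ.smooth.continuous.memLp_of_hasCompactSupport hφ.hasCompactSupport).restrict _

theorem IsTestFunction.memLp_gradient {φ : Space → ℝ} (hφ : IsTestFunction φ) :
    MemLp (∇ φ) 2 cubeMeasure := by
  refine (hφ.continuous_gradient.memLp_of_hasCompactSupport ?_).restrict _
  exact (hφ.hasCompactSupport.fderiv ℝ).comp_left
    (g := (InnerProductSpace.toDual ℝ Space).symm) (map_zero _)

theorem IsTestFunction.zero : IsTestFunction (0 : Space → ℝ) where
  smooth := contDiff_const
  hasCompactSupport := HasCompactSupport.zero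
  tsupport_subset := by simp [tsupport]

theorem IsTestFunction.add {φ ψ : Space → ℝ} (hφ : IsTestFunction φ)
    (hψ : IsTestFunction ψ) : IsTestFunction (φ + ψ) where
  smooth := hφ.smooth.add hψ.smooth
  hasCompactSupport := hφ.hasCompactSupport.add hψ.hasCompactSupport
  tsupport_subset := (tsupport_add φ ψ).trans
    (Set.union_subset hφ.tsupport_subset hψ.tsupport_subset)

theorem IsTestFunction.smul {φ : Space → ℝ} (c : ℝ) (hφ : IsTestFunction φ) :
    IsTestFunction (c • φ) where
  smooth := contDiff_const.smul hφ.smooth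
  hasCompactSupport := hφ.hasCompactSupport.smul_left (f := fun _ => c)
  tsupport_subset := (closure_mono (Function.support_const_smul_subset c φ)).trans
    hφ.tsupport_subset

theorem IsTestFunction.gradient_add {φ ψ : Space → ℝ} (hφ : IsTestFunction φ)
    (hψ : IsTestFunction ψ) : ∇ (φ + ψ) = ∇ φ + ∇ ψ := by
  funext x
  simp only [gradient, Pi.add_apply]
  rw [fderiv_add (hφ.smooth.differentiable (by simp) x)
    (hψ.smooth.differentiable (by simp) x), map_add]

theorem IsTestFunction.gradient_smul {φ : Space → ℝ} (c : ℝ) (hφ : IsTestFunction φ) :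
    ∇ (c • φ) = c • ∇ φ := by
  funext x
  simp only [gradient, Pi.smul_apply]
  rw [fderiv_const_smul (hφ.smooth.differentiable (by simp) x)]
  simp

theorem integrable_smul_of_memLp {u : Space → ℝ} {g : Space → Space}
    (hu : MemLp u 2 cubeMeasure) (hg : MemLp g 2 cubeMeasure) :
    Integrable (fun x => u x • g x) cubeMeasure :=
  memLp_one_iff_integrable.1 (hg.smul hu)

/-- `H¹(Ω)`: the pairs `(u, g)` of `L²` functions such that `g` is the weak gradient of `u`.
As `g` is determined by `u`, this is the space of `u ∈ L²(Ω)` with weak gradient in `L²(Ω)`;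
its norm is `(∫ |u|² + ∫ |∇u|²)^(1/2)`. -/
noncomputable def H1 : Submodule ℝ L2Pair where
  carrier := {u | IsWeakGradient u.fst u.snd}
  zero_mem' := by
    intro φ hφ
    have h1 : ∫ x in cube, ((0 : L2Pair).fst : Space → ℝ) x • (∇ φ) x = 0 := by
      refine integral_eq_zero_of_ae ?_
      filter_upwards [Lp.coeFn_zero ℝ 2 cubeMeasure] with x hx
      simp only [WithLp.zero_fst, hx, Pi.zero_apply, zero_smul]
    have h2 : ∫ x in cube, φ x • ((0 : L2Pair).snd : Space → Space) x = 0 := by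
      refine integral_eq_zero_of_ae ?_
      filter_upwards [Lp.coeFn_zero Space 2 cubeMeasure] with x hx
      simp only [WithLp.zero_snd, hx, Pi.zero_apply, smul_zero]
    rw [h1, h2, neg_zero]
  add_mem' := by
    intro u v hu hv φ hφ
    have h1 : ∫ x in cube, ((u + v).fst : Space → ℝ) x • (∇ φ) x
        = (∫ x in cube, (u.fst : Space → ℝ) x • (∇ φ) x)
          + ∫ x in cube, (v.fst : Space → ℝ) x • (∇ φ) x := by
      rw [← integral_add (integrable_smul_of_memLp (Lp.memLp _) hφ.memLp_gradient)
        (integrable_smul_of_memLp (Lp.memLp _) hφ.memLp_gradient)]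
      refine integral_congr_ae ?_
      filter_upwards [Lp.coeFn_add u.fst v.fst] with x hx
      simp only [WithLp.add_fst, hx, Pi.add_apply, add_smul]
    have h2 : ∫ x in cube, φ x • ((u + v).snd : Space → Space) x
        = (∫ x in cube, φ x • (u.snd : Space → Space) x)
          + ∫ x in cube, φ x • (v.snd : Space → Space) x := by
      rw [← integral_add (integrable_smul_of_memLp hφ.memLp (Lp.memLp _))
        (integrable_smul_of_memLp hφ.memLp (Lp.memLp _))]
      refine integral_congr_ae ?_
      filter_upwards [Lp.coeFn_add u.snd v.snd] with x hx
      simp only [WithLp.add_snd, hx, Pi.add_apply, smul_add]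
    rw [h1, h2, hu φ hφ, hv φ hφ, neg_add]
  smul_mem' := by
    intro c u hu φ hφ
    have h1 : ∫ x in cube, ((c • u).fst : Space → ℝ) x • (∇ φ) x
        = c • ∫ x in cube, (u.fst : Space → ℝ) x • (∇ φ) x := by
      rw [← integral_smul]
      refine integral_congr_ae ?_
      filter_upwards [Lp.coeFn_smul c u.fst] with x hx
      simp only [WithLp.smul_fst, hx, Pi.smul_apply, smul_assoc]
    have h2 : ∫ x in cube, φ x • ((c • u).snd : Space → Space) x
        = c • ∫ x in cube, φ x • (u.snd : Space → Space) x := by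
      rw [← integral_smul]
      refine integral_congr_ae ?_
      filter_upwards [Lp.coeFn_smul c u.snd] with x hx
      simp only [WithLp.smul_snd, hx, Pi.smul_apply, smul_comm c]
    rw [h1, h2, hu φ hφ, smul_neg]

/-- The copy of `C_c^∞((0,1)³)` in `H¹(Ω)`. -/
noncomputable def testSubspace : Submodule ℝ H1 where
  carrier := {u | ∃ φ : Space → ℝ, IsTestFunction φ ∧
    u.1.fst =ᵐ[cubeMeasure] φ ∧ u.1.snd =ᵐ[cubeMeasure] ∇ φ}
  zero_mem' := by
    refine ⟨0, IsTestFunction.zero, Lp.coeFn_zero ℝ 2 cubeMeasure, ?_⟩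
    filter_upwards [Lp.coeFn_zero Space 2 cubeMeasure] with x hx
    simpa [gradient] using hx
  add_mem' := by
    rintro u v ⟨φ, hφ, h1, h2⟩ ⟨ψ, hψ, h3, h4⟩
    refine ⟨φ + ψ, hφ.add hψ, (Lp.coeFn_add _ _).trans (h1.add h3), ?_⟩
    rw [hφ.gradient_add hψ]
    exact (Lp.coeFn_add _ _).trans (h2.add h4)
  smul_mem' := by
    rintro c u ⟨φ, hφ, h1, h2⟩
    refine ⟨c • φ, hφ.smul c, (Lp.coeFn_smul _ _).trans (h1.const_smul c), ?_⟩
    rw [hφ.gradient_smul c]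
    exact (Lp.coeFn_smul _ _).trans (h2.const_smul c)

/-- `H¹₀(Ω)`: the closure of `C_c^∞((0,1)³)` in `H¹(Ω)`, with the norm of `H¹(Ω)`. -/
noncomputable def H10 : Submodule ℝ H1 := testSubspace.topologicalClosure

/-- The `L²` function underlying an element of `H¹₀(Ω)`. -/
noncomputable def toL2 (u : H10) : Lp ℝ 2 cubeMeasure := u.1.1.fst

/-- The weak gradient of an element of `H¹₀(Ω)`. -/
noncomputable def grad (u : H10) : Lp Space 2 cubeMeasure := u.1.1.snd

/-! ### The eigenvalue problem -/

/-- `f` is piecewise constant on `Ω`: it takes finitely many values there, each of them on a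
Lebesgue measurable set. -/
structure IsPiecewiseConstant (f : Space → ℝ) : Prop where
  finite_image : (f '' cube).Finite
  nullMeasurableSet : ∀ c : ℝ, NullMeasurableSet {x ∈ cube | f x = c} volume

/-- `a(φ, ψ) = ∫_Ω (D ∇φ · ∇ψ + Σₐ φ ψ)`. -/
noncomputable def formA (D Sa : Space → ℝ) (φ ψ : H10) : ℝ :=
  ∫ x in cube, (D x * inner ℝ (grad φ x) (grad ψ x) + Sa x * toL2 φ x * toL2 ψ x)

/-- `b(φ, ψ) = ∫_Ω νΣ_f φ ψ`. -/
noncomputable def formB (nuSf : Space → ℝ) (φ ψ : H10) : ℝ :=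
  ∫ x in cube, nuSf x * toL2 φ x * toL2 ψ x

/-! ### The finite element spaces -/

/-- The admissible mesh sizes: `0 < h < 1` with `1 / h` a natural number. -/
def meshSizes : Set ℝ := {h | 0 < h ∧ h < 1 ∧ ∃ n : ℕ, (n : ℝ) * h = 1}

/-- The trilinear functions `span {1, x, y, z, xy, xz, yz, xyz}`. -/
def Q1 : Submodule ℝ (Space → ℝ) :=
  Submodule.span ℝ {fun _ => 1, fun x => x 0, fun x => x 1, fun x => x 2,
    fun x => x 0 * x 1, fun x => x 0 * x 2, fun x => x 1 * x 2, fun x => x 0 * x 1 * x 2}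

/-- The corner `((p₀ - 1) h, (p₁ - 1) h, (p₂ - 1) h)` of a cell. -/
noncomputable def corner (h : ℝ) (p : Fin 3 → ℕ) : Space :=
  WithLp.toLp 2 fun i => ((p i : ℝ) - 1) * h

/-- The cell `∏ᵢ [(pᵢ - 1) h, pᵢ h]` of the uniform mesh of size `h`. -/
def cell (h : ℝ) (p : Fin 3 → ℕ) : Set Space :=
  {x | ∀ i, x i ∈ Set.Icc (((p i : ℝ) - 1) * h) ((p i : ℝ) * h)}

/-- `V₀ʰ`: the functions in `H¹₀(Ω)` whose restriction to each cell is a translate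
from the reference cube `[0,h]³` of a trilinear function. The index `p` of a cell has
`1 ≤ pᵢ ≤ 1 / h`. Equality of functions in `H¹₀(Ω)` is equality almost everywhere. -/
noncomputable def femSpace (h : ℝ) : Submodule ℝ H10 where
  carrier := {u | ∀ p : Fin 3 → ℕ, (∀ i, 1 ≤ p i ∧ (p i : ℝ) * h ≤ 1) →
    ∃ q ∈ Q1, ∀ᵐ x ∂volume.restrict (cell h p), x ∈ cube → toL2 u x = q (x - corner h p)}
  zero_mem' := by
    intro p _
    refine ⟨0, Q1.zero_mem, ae_restrict_of_ae ?_⟩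
    exact ae_imp_of_ae_restrict (Lp.coeFn_zero ℝ 2 cubeMeasure)
  add_mem' := by
    intro u v hu hv p hp
    obtain ⟨q, hq, h1⟩ := hu p hp
    obtain ⟨r, hr, h2⟩ := hv p hp
    refine ⟨q + r, Q1.add_mem hq hr, ?_⟩
    filter_upwards [h1, h2, ae_restrict_of_ae
      (ae_imp_of_ae_restrict (Lp.coeFn_add (toL2 u) (toL2 v)))] with x hx1 hx2 hx hxc
    exact (hx hxc).trans (by simp [hx1 hxc, hx2 hxc])
  smul_mem' := by
    intro c u hu p hp
    obtain ⟨q, hq, h1⟩ := hu p hp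
    refine ⟨c • q, Q1.smul_mem c hq, ?_⟩
    filter_upwards [h1, ae_restrict_of_ae
      (ae_imp_of_ae_restrict (Lp.coeFn_smul c (toL2 u)))] with x hx1 hx hxc
    exact (hx hxc).trans (by simp [hx1 hxc])

/-! ### The Babuška–Osborn conditions -/

/-- `F` is linear in each argument. -/
def IsBilinear (F : H10 → H10 → ℝ) : Prop :=
  (∀ ψ, IsLinearMap ℝ fun φ => F φ ψ) ∧ ∀ φ, IsLinearMap ℝ (F φ)

/-- The Babuška–Osborn conditions for the eigenvalue problem `A(φ, ψ) = λ B(φ, ψ)` on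
`H¹₀(Ω)`, its Galerkin discretization by the subspaces `V h` with `h` in the set `S` of mesh
sizes, and the discrete inf-sup function `β`. Infima and suprema of `|A(φ, ψ)|` are taken in
`[0, ∞]`. -/
structure BabuskaOsbornWith (A B : H10 → H10 → ℝ) (S : Set ℝ) (V : ℝ → Submodule ℝ H10)
    (β : ℝ → ℝ) : Prop where
  bilinear_A : IsBilinear A
  bounded_A : ∃ C : ℝ, 0 < C ∧ ∀ φ ψ, |A φ ψ| ≤ C * ‖φ‖ * ‖ψ‖
  infSup_one : ∃ α : ℝ, 0 < α ∧
    ENNReal.ofReal α ≤ ⨅ φ : {φ : H10 // ‖φ‖ = 1}, ⨆ ψ : {ψ : H10 // ‖ψ‖ = 1},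
      ENNReal.ofReal |A φ.1 ψ.1|
  infSup_two : ∀ ψ : H10, ψ ≠ 0 → 0 < ⨆ φ : H10, ENNReal.ofReal |A φ ψ|
  bilinear_B : IsBilinear B
  bounded_B : ∃ C : ℝ, 0 < C ∧ ∀ φ ψ, |B φ ψ| ≤ C * ‖toL2 φ‖ * ‖ψ‖
  beta_pos : ∀ h, 0 < h → 0 < β h
  discrete_infSup_one : ∀ h ∈ S,
    ENNReal.ofReal (β h) ≤
      ⨅ φ : {φ : H10 // φ ∈ V h ∧ ‖φ‖ = 1}, ⨆ ψ : {ψ : H10 // ψ ∈ V h ∧ ‖ψ‖ = 1},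
        ENNReal.ofReal |A φ.1 ψ.1|
  discrete_infSup_two : ∀ h ∈ S, ∀ ψ ∈ V h, ψ ≠ 0 →
    0 < ⨆ φ : V h, ENNReal.ofReal |A φ.1 ψ|
  approximation : ∀ φ : H10,
    Tendsto (fun h => (β h)⁻¹ * ⨅ χ : V h, ‖φ - χ.1‖) (𝓝[S] 0) (𝓝 0)

end NeutronDiffusion

namespace NeutronDiffusion

/-! ### Measurability of the cube and of piecewise constant coefficients -/

/-! Everything except the approximation property follows from coercivity. Since `‖φ‖ ^ 2` is the sum
of the squared `L²` norms of `φ` and its gradient, a common lower bound `c` of `D` and `Sa` gives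
`a(φ, φ) ≥ c ‖φ‖ ^ 2` (`le_formA_self`). Taking `ψ = φ` in the suprema yields the inf-sup conditions
on `H10` and on every subspace with the same constant, hence independence of `h`. Continuity of both
forms is Cauchy–Schwarz for nonnegative symmetric forms (`IsBilinear.abs_le`).

As `β` is constant, the approximation property says that the spaces `femSpace h` become dense. Test
functions are dense in `H10` by definition, so it suffices to approximate a test function `ψ` by its
nodal trilinear interpolant. This requires two things.

The interpolant must lie in `H10`. The hat function is a bounded pointwise limit of smooth functions
supported inside `(-1, 1)`, with derivatives also converging boundedly, so the interpolant is a
limit of test functions (`exists_H10_of_tendsto`, `exists_H10_nodalSum`).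

The error must tend to zero in `H¹`. On a cell the eight nodal functions sum to one, and their
gradients reproduce those of affine functions. The errors of value and gradient are therefore
controlled by the oscillation of `ψ` and `fderiv ℝ ψ` over distance `2 * h` (`abs_nodalSum_sub_le`,
`norm_nodalGrad_sub_le`). Uniform continuity finishes the argument; no second derivatives are
needed. -/

theorem isClosed_cube : IsClosed cube := by
  have : cube = ⋂ i, {x : Space | x i ∈ Set.Icc (0 : ℝ) 1} := by
    ext x; simp [cube]
  rw [this]
  exact isClosed_iInter fun i => isClosed_Icc.preimage (by fun_prop)

theorem measurableSet_cube : MeasurableSet cube := isClosed_cube.measurableSet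

theorem openCube_subset_cube : openCube ⊆ cube := fun _ hx i => Set.Ioo_subset_Icc_self (hx i)

theorem zero_mem_cube : (0 : Space) ∈ cube := fun i => by simp

theorem volume_cube : volume cube = 1 := by
  have h : cube = (MeasurableEquiv.toLp 2 (Fin 3 → ℝ)).symm ⁻¹'
      (Set.pi Set.univ fun _ => Set.Icc (0 : ℝ) 1) := by
    ext x
    exact ⟨fun hx i _ => hx i, fun hx i => hx i trivial⟩
  rw [h, (EuclideanSpace.volume_preserving_symm_measurableEquiv_toLp
    (Fin 3)).measure_preimage_equiv, volume_pi_pi]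
  simp

instance : IsProbabilityMeasure cubeMeasure :=
  ⟨by rw [Measure.restrict_apply_univ, volume_cube]⟩

/-- On the cube `f` is the finite sum of its values times the indicators of its level sets. -/
theorem IsPiecewiseConstant.aestronglyMeasurable {f : Space → ℝ} (hf : IsPiecewiseConstant f) :
    AEStronglyMeasurable f cubeMeasure := by
  classical
  have hsum : AEStronglyMeasurable (fun x => ∑ c ∈ hf.finite_image.toFinset,
      {x ∈ cube | f x = c}.indicator (fun _ => c) x) cubeMeasure := by
    refine Finset.aestronglyMeasurable_fun_sum _ fun c _ => ?_
    exact aestronglyMeasurable_const.indicator₀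
      ((hf.nullMeasurableSet c).mono Measure.restrict_le_self)
  refine hsum.congr ?_
  filter_upwards [ae_restrict_mem measurableSet_cube] with x hx
  rw [Finset.sum_eq_single (f x)]
  · simp [hx]
  · intro c _ hc
    exact Set.indicator_of_notMem (fun h => hc h.2.symm) _
  · intro h
    exact absurd (by simpa using ⟨x, hx, rfl⟩) h

theorem IsPiecewiseConstant.exists_bound {f : Space → ℝ} (hf : IsPiecewiseConstant f) :
    ∃ C : ℝ, 0 < C ∧ ∀ x ∈ cube, |f x| ≤ C := by
  obtain ⟨C, hC⟩ := (hf.finite_image.image fun y => |y|).bddAbove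
  refine ⟨max C 1, by positivity, fun x hx => le_max_of_le_left (hC ?_)⟩
  exact ⟨f x, ⟨x, hx, rfl⟩, rfl⟩

theorem IsPiecewiseConstant.exists_isLeast {f : Space → ℝ} (hf : IsPiecewiseConstant f) :
    ∃ c, IsLeast (f '' cube) c := by
  obtain ⟨c, hc, h⟩ := hf.finite_image.exists_minimalFor id _ ⟨f 0, 0, zero_mem_cube, rfl⟩
  refine ⟨c, hc, fun y hy => ?_⟩
  rcases le_total c y with h1 | h1
  · exact h1
  · exact h hy h1

/-! ### Weighted inner products -/

section Weighted

variable {E : Type*} [NormedAddCommGroup E] [InnerProductSpace ℝ E]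

theorem integrable_weighted_inner {w : Space → ℝ} (hw : IsPiecewiseConstant w)
    (f g : Lp E 2 cubeMeasure) :
    Integrable (fun x => w x * inner ℝ (f x) (g x)) cubeMeasure := by
  obtain ⟨C, -, hC⟩ := hw.exists_bound
  refine (L2.integrable_inner f g).bdd_mul (c := C) hw.aestronglyMeasurable ?_
  filter_upwards [ae_restrict_mem measurableSet_cube] with x hx
  exact hC x hx

/-- `∫_Ω w f · g`. -/
noncomputable def weightedInner (w : Space → ℝ) (f g : Lp E 2 cubeMeasure) : ℝ :=
  ∫ x in cube, w x * inner ℝ (f x) (g x)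

theorem weightedInner_comm (w : Space → ℝ) (f g : Lp E 2 cubeMeasure) :
    weightedInner w f g = weightedInner w g f := by
  simp only [weightedInner, real_inner_comm]

theorem weightedInner_add_left {w : Space → ℝ} (hw : IsPiecewiseConstant w)
    (f f' g : Lp E 2 cubeMeasure) :
    weightedInner w (f + f') g = weightedInner w f g + weightedInner w f' g := by
  rw [weightedInner, weightedInner, weightedInner,
    ← integral_add (integrable_weighted_inner hw f g) (integrable_weighted_inner hw f' g)]
  refine integral_congr_ae ?_
  filter_upwards [Lp.coeFn_add f f'] with x hx
  simp only [hx, Pi.add_apply, inner_add_left, mul_add]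

theorem weightedInner_smul_left (w : Space → ℝ) (c : ℝ) (f g : Lp E 2 cubeMeasure) :
    weightedInner w (c • f) g = c * weightedInner w f g := by
  rw [weightedInner, weightedInner, ← integral_const_mul]
  refine integral_congr_ae ?_
  filter_upwards [Lp.coeFn_smul c f] with x hx
  simp only [hx, Pi.smul_apply, real_inner_smul_left]
  ring

theorem integral_inner_self (f : Lp E 2 cubeMeasure) :
    ∫ x in cube, inner ℝ (f x) (f x) = ‖f‖ ^ 2 := by
  rw [← real_inner_self_eq_norm_sq, L2.inner_def]

theorem weightedInner_self_le {w : Space → ℝ} (hw : IsPiecewiseConstant w) {C : ℝ}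
    (hC : ∀ x ∈ cube, w x ≤ C) (f : Lp E 2 cubeMeasure) :
    weightedInner w f f ≤ C * ‖f‖ ^ 2 := by
  rw [weightedInner, ← integral_inner_self, ← integral_const_mul]
  refine integral_mono_ae (integrable_weighted_inner hw f f)
    ((L2.integrable_inner f f).const_mul C) ?_
  filter_upwards [ae_restrict_mem measurableSet_cube] with x hx
  exact mul_le_mul_of_nonneg_right (hC x hx) real_inner_self_nonneg

theorem le_weightedInner_self {w : Space → ℝ} (hw : IsPiecewiseConstant w) {c : ℝ}
    (hc : ∀ x ∈ cube, c ≤ w x) (f : Lp E 2 cubeMeasure) :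
    c * ‖f‖ ^ 2 ≤ weightedInner w f f := by
  rw [weightedInner, ← integral_inner_self, ← integral_const_mul]
  refine integral_mono_ae ((L2.integrable_inner f f).const_mul c)
    (integrable_weighted_inner hw f f) ?_
  filter_upwards [ae_restrict_mem measurableSet_cube] with x hx
  exact mul_le_mul_of_nonneg_right (hc x hx) real_inner_self_nonneg

end Weighted

/-! ### The two bilinear forms -/

theorem norm_sq_eq (u : H10) : ‖u‖ ^ 2 = ‖toL2 u‖ ^ 2 + ‖grad u‖ ^ 2 :=
  WithLp.prod_norm_sq_eq_of_L2 u.1.1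

theorem norm_toL2_le (u : H10) : ‖toL2 u‖ ≤ ‖u‖ :=
  le_of_sq_le_sq (by rw [norm_sq_eq]; linarith [sq_nonneg ‖grad u‖]) (norm_nonneg _)

theorem formB_eq (w : Space → ℝ) (φ ψ : H10) :
    formB w φ ψ = weightedInner w (toL2 φ) (toL2 ψ) := by
  unfold formB weightedInner
  refine integral_congr_ae (Eventually.of_forall fun x => ?_)
  simp only [RCLike.inner_apply, conj_trivial]
  ring

theorem formA_eq {D Sa : Space → ℝ} (hD : IsPiecewiseConstant D) (hSa : IsPiecewiseConstant Sa)
    (φ ψ : H10) :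
    formA D Sa φ ψ = weightedInner D (grad φ) (grad ψ) + weightedInner Sa (toL2 φ) (toL2 ψ) := by
  rw [weightedInner, weightedInner,
    ← integral_add (integrable_weighted_inner hD _ _) (integrable_weighted_inner hSa _ _)]
  refine integral_congr_ae (Eventually.of_forall fun x => ?_)
  simp only [RCLike.inner_apply, conj_trivial]
  ring

theorem isBilinear_of_symm {F : H10 → H10 → ℝ} (hsymm : ∀ φ ψ, F φ ψ = F ψ φ)
    (hadd : ∀ φ φ' ψ, F (φ + φ') ψ = F φ ψ + F φ' ψ)
    (hsmul : ∀ (c : ℝ) φ ψ, F (c • φ) ψ = c * F φ ψ) : IsBilinear F := by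
  refine ⟨fun ψ => ⟨fun φ φ' => hadd φ φ' ψ, fun c φ => hsmul c φ ψ⟩,
    fun φ => ⟨fun ψ ψ' => ?_, fun c ψ => ?_⟩⟩
  · rw [hsymm, hadd, hsymm ψ, hsymm ψ']
  · rw [hsymm, hsmul, hsymm ψ, smul_eq_mul]

theorem formB_symm (w : Space → ℝ) (φ ψ : H10) : formB w φ ψ = formB w ψ φ := by
  rw [formB_eq, formB_eq, weightedInner_comm]

theorem formA_symm {D Sa : Space → ℝ} (hD : IsPiecewiseConstant D)
    (hSa : IsPiecewiseConstant Sa) (φ ψ : H10) : formA D Sa φ ψ = formA D Sa ψ φ := by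
  rw [formA_eq hD hSa, formA_eq hD hSa, weightedInner_comm, weightedInner_comm Sa]

theorem isBilinear_formB {w : Space → ℝ} (hw : IsPiecewiseConstant w) :
    IsBilinear (formB w) := by
  refine isBilinear_of_symm (formB_symm w) (fun φ φ' ψ => ?_) fun c φ ψ => ?_
  · simp only [formB_eq]
    exact weightedInner_add_left hw (toL2 φ) (toL2 φ') (toL2 ψ)
  · simp only [formB_eq]
    exact weightedInner_smul_left w c (toL2 φ) (toL2 ψ)

theorem isBilinear_formA {D Sa : Space → ℝ} (hD : IsPiecewiseConstant D)
    (hSa : IsPiecewiseConstant Sa) : IsBilinear (formA D Sa) := by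
  refine isBilinear_of_symm (formA_symm hD hSa) (fun φ φ' ψ => ?_) fun c φ ψ => ?_
  · simp only [formA_eq hD hSa]
    have h1 := weightedInner_add_left hD (grad φ) (grad φ') (grad ψ)
    have h2 := weightedInner_add_left hSa (toL2 φ) (toL2 φ') (toL2 ψ)
    -- `grad` and `toL2` are projections, so additivity is definitional.
    change weightedInner D (grad φ + grad φ') (grad ψ)
      + weightedInner Sa (toL2 φ + toL2 φ') (toL2 ψ) = _
    rw [h1, h2]; ring
  · simp only [formA_eq hD hSa]
    have h1 := weightedInner_smul_left D c (grad φ) (grad ψ)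
    have h2 := weightedInner_smul_left Sa c (toL2 φ) (toL2 ψ)
    change weightedInner D (c • grad φ) (grad ψ)
      + weightedInner Sa (c • toL2 φ) (toL2 ψ) = _
    rw [h1, h2]; ring

/-- A symmetric nonnegative bilinear form is bounded by its values on the diagonal. -/
theorem IsBilinear.abs_le {F : H10 → H10 → ℝ} (hF : IsBilinear F)
    (hsymm : ∀ φ ψ, F φ ψ = F ψ φ) (hnonneg : ∀ φ, 0 ≤ F φ φ) {C : ℝ} (hC : 0 ≤ C)
    {N : H10 → ℝ} (hN : ∀ φ, 0 ≤ N φ) (hle : ∀ φ, F φ φ ≤ C * N φ ^ 2) (φ ψ : H10) :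
    |F φ ψ| ≤ C * N φ * N ψ := by
  let B : LinearMap.BilinForm ℝ H10 := LinearMap.mk₂ ℝ F (fun a b ψ => (hF.1 ψ).map_add a b)
    (fun c a ψ => (hF.1 ψ).map_smul c a) (fun φ a b => (hF.2 φ).map_add a b)
    (fun c φ a => (hF.2 φ).map_smul c a)
  -- Cauchy–Schwarz needs only semidefiniteness. The gauge `N` is left free: it is the `L²` norm for
  -- `formB` and the full norm for `formA`.
  have h : F φ ψ * F ψ φ ≤ F φ φ * F ψ ψ :=
    LinearMap.BilinForm.apply_mul_apply_le_of_forall_zero_le B hnonneg φ ψ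
  refine abs_le_of_sq_le_sq ?_ (mul_nonneg (mul_nonneg hC (hN _)) (hN _))
  calc F φ ψ ^ 2 = F φ ψ * F ψ φ := by rw [hsymm ψ φ, sq]
    _ ≤ F φ φ * F ψ ψ := h
    _ ≤ (C * N φ ^ 2) * (C * N ψ ^ 2) :=
      mul_le_mul (hle φ) (hle ψ) (hnonneg ψ) (mul_nonneg hC (sq_nonneg _))
    _ = (C * N φ * N ψ) ^ 2 := by ring

theorem formB_bounded {w : Space → ℝ} (hw : IsPiecewiseConstant w)
    (hpos : ∀ x ∈ cube, 0 ≤ w x) :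
    ∃ C : ℝ, 0 < C ∧ ∀ φ ψ, |formB w φ ψ| ≤ C * ‖toL2 φ‖ * ‖ψ‖ := by
  obtain ⟨C, hC0, hC⟩ := hw.exists_bound
  refine ⟨C, hC0, fun φ ψ => ?_⟩
  calc |formB w φ ψ| ≤ C * ‖toL2 φ‖ * ‖toL2 ψ‖ := by
        refine (isBilinear_formB hw).abs_le (formB_symm w) (fun φ => ?_) hC0.le
          (N := fun φ => ‖toL2 φ‖) (fun _ => norm_nonneg _) (fun φ => ?_) φ ψ
        · have := le_weightedInner_self hw hpos (toL2 φ)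
          rw [formB_eq]; linarith
        · rw [formB_eq]
          exact weightedInner_self_le hw (fun x hx => (le_abs_self _).trans (hC x hx)) _
    _ ≤ C * ‖toL2 φ‖ * ‖ψ‖ := by gcongr; exact norm_toL2_le ψ

/-- Coercivity. The absorption term controls the `L²` part directly, so neither a Poincaré
inequality nor the boundary condition enters. -/
theorem le_formA_self {D Sa : Space → ℝ} (hD : IsPiecewiseConstant D)
    (hSa : IsPiecewiseConstant Sa) {c : ℝ} (h1 : ∀ x ∈ cube, c ≤ D x)
    (h2 : ∀ x ∈ cube, c ≤ Sa x) (φ : H10) : c * ‖φ‖ ^ 2 ≤ formA D Sa φ φ := by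
  rw [formA_eq hD hSa, norm_sq_eq]
  linarith [le_weightedInner_self hD h1 (grad φ), le_weightedInner_self hSa h2 (toL2 φ)]

theorem formA_bounded {D Sa : Space → ℝ} (hD : IsPiecewiseConstant D)
    (hSa : IsPiecewiseConstant Sa) (hDpos : ∀ x ∈ cube, 0 < D x)
    (hSapos : ∀ x ∈ cube, 0 < Sa x) :
    ∃ C : ℝ, 0 < C ∧ ∀ φ ψ, |formA D Sa φ ψ| ≤ C * ‖φ‖ * ‖ψ‖ := by
  obtain ⟨C, hC0, hC⟩ := hD.exists_bound
  obtain ⟨C', hC0', hC'⟩ := hSa.exists_bound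
  refine ⟨max C C', by positivity, (isBilinear_formA hD hSa).abs_le (formA_symm hD hSa)
    (fun φ => ?_) (by positivity) (fun _ => norm_nonneg _) fun φ => ?_⟩
  -- Coercivity with constant `c = 0` is the nonnegativity required here.
  · have := le_formA_self hD hSa (fun x hx => (hDpos x hx).le) (fun x hx => (hSapos x hx).le) φ
    linarith
  · rw [formA_eq hD hSa, norm_sq_eq]
    have h1 := weightedInner_self_le hD
      (fun x hx => (le_abs_self _).trans ((hC x hx).trans (le_max_left C C'))) (grad φ)
    have h2 := weightedInner_self_le hSa
      (fun x hx => (le_abs_self _).trans ((hC' x hx).trans (le_max_right C C'))) (toL2 φ)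
    linarith

/-! ### Elements of `H¹₀(Ω)` as limits of test functions -/

theorem IsTestFunction.eq_zero_of_notMem_cube {φ : Space → ℝ} (hφ : IsTestFunction φ) {x : Space}
    (hx : x ∉ cube) : φ x = 0 :=
  image_eq_zero_of_notMem_tsupport fun h =>
    hx (openCube_subset_cube (hφ.tsupport_subset h))

theorem inner_gradient_eq_fderiv (φ : Space → ℝ) (v x : Space) :
    inner ℝ v ((∇ φ) x) = fderiv ℝ φ x v := by
  rw [real_inner_comm]
  exact InnerProductSpace.toDual_symm_apply

/-- Integration by parts: the classical gradient of a test function is its weak gradient. -/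
theorem IsTestFunction.isWeakGradient {φ : Space → ℝ} (hφ : IsTestFunction φ) :
    IsWeakGradient φ (∇ φ) := by
  intro η hη
  have hI : ∀ {α β : Space → ℝ}, IsTestFunction α → IsTestFunction β →
      Integrable (fun x => α x • (∇ β) x) volume := fun {α β} hα hβ =>
    (hα.smooth.continuous.smul hβ.continuous_gradient).integrable_of_hasCompactSupport
      (hα.hasCompactSupport.smul_right)
  -- Both integrands vanish off the cube, so one may integrate over the whole space, where no
  -- boundary term arises.
  rw [setIntegral_eq_integral_of_forall_compl_eq_zero fun x hx => by
      rw [hφ.eq_zero_of_notMem_cube hx, zero_smul],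
    setIntegral_eq_integral_of_forall_compl_eq_zero fun x hx => by
      rw [hη.eq_zero_of_notMem_cube hx, zero_smul]]
  -- Pairing with a fixed vector `v` reduces the claim to scalar integration by parts in the
  -- direction `v`.
  refine ext_inner_left ℝ fun v => ?_
  have h1 := hI hφ hη
  have h2 := hI hη hφ
  rw [inner_neg_right, ← integral_inner h1, ← integral_inner h2]
  simp only [inner_smul_right, inner_gradient_eq_fderiv]
  have h3 := h1.const_inner (𝕜 := ℝ) v
  have h4 := h2.const_inner (𝕜 := ℝ) v
  simp only [inner_smul_right, inner_gradient_eq_fderiv] at h3 h4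
  rw [integral_mul_fderiv_eq_neg_fderiv_mul_of_integrable (𝕜 := ℝ)
    (by simpa only [mul_comm] using h4) h3
    ((hφ.smooth.continuous.mul hη.smooth.continuous).integrable_of_hasCompactSupport
      hφ.hasCompactSupport.mul_right)
    (fun x _ => hφ.smooth.differentiable (by simp) x)
    (fun x _ => hη.smooth.differentiable (by simp) x)]
  simp only [mul_comm]

section BoundedConvergence

variable {α E : Type*} [MeasurableSpace α] [NormedAddCommGroup E] {μ : Measure α}
  [IsFiniteMeasure μ] {f : ℕ → α → E} {g : α → E} {C : ℝ}

theorem memLp_two_of_tendsto_ae_of_bounded (hf : ∀ n, AEStronglyMeasurable (f n) μ)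
    (hC : ∀ n x, ‖f n x‖ ≤ C) (hlim : ∀ᵐ x ∂μ, Tendsto (fun n => f n x) atTop (𝓝 (g x))) :
    MemLp g 2 μ := by
  refine MemLp.of_bound (aestronglyMeasurable_of_tendsto_ae atTop hf hlim) C ?_
  filter_upwards [hlim] with x hx
  exact le_of_tendsto hx.norm (Eventually.of_forall fun n => hC n x)

/-- Vitali's theorem: a uniformly bounded sequence is uniformly integrable, since nothing exceeds
the cutoff `C + 1`. -/
theorem tendsto_eLpNorm_two_of_tendsto_ae_of_bounded (hf : ∀ n, AEStronglyMeasurable (f n) μ)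
    (hC : ∀ n x, ‖f n x‖ ≤ C) (hlim : ∀ᵐ x ∂μ, Tendsto (fun n => f n x) atTop (𝓝 (g x))) :
    Tendsto (fun n => eLpNorm (f n - g) 2 μ) atTop (𝓝 0) := by
  refine tendsto_Lp_finite_of_tendsto_ae (by norm_num) (by norm_num) hf
    (memLp_two_of_tendsto_ae_of_bounded hf hC hlim)
    (unifIntegrable_of (by norm_num) (by norm_num) hf fun ε hε => ⟨(C + 1).toNNReal, fun n => ?_⟩)
    hlim
  have : {x | (C + 1).toNNReal ≤ ‖f n x‖₊} = ∅ := by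
    ext x
    simp only [Set.mem_ofPred_eq, Set.mem_empty_iff_false, iff_false, not_le]
    rw [← NNReal.coe_lt_coe, coe_nnnorm]
    exact (hC n x).trans_lt ((lt_add_one C).trans_le (Real.le_coe_toNNReal _))
  simp [this]

end BoundedConvergence

theorem IsTestFunction.exists_mem_testSubspace {φ : Space → ℝ} (hφ : IsTestFunction φ) :
    ∃ u ∈ testSubspace, u.1 = WithLp.toLp 2 (hφ.memLp.toLp φ, hφ.memLp_gradient.toLp (∇ φ)) := by
  have h1 := hφ.memLp.coeFn_toLp
  have h2 := hφ.memLp_gradient.coeFn_toLp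
  refine ⟨⟨WithLp.toLp 2 (hφ.memLp.toLp φ, hφ.memLp_gradient.toLp (∇ φ)), fun η hη => ?_⟩,
    ⟨φ, hφ, h1, h2⟩, rfl⟩
  have h3 : ∫ x in cube, (hφ.memLp.toLp φ) x • (∇ η) x = ∫ x in cube, φ x • (∇ η) x := by
    refine integral_congr_ae ?_
    filter_upwards [h1] with x hx
    rw [hx]
  have h4 : ∫ x in cube, η x • (hφ.memLp_gradient.toLp (∇ φ)) x
      = ∫ x in cube, η x • (∇ φ) x := by
    refine integral_congr_ae ?_
    filter_upwards [h2] with x hx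
    rw [hx]
  exact (h3.trans (hφ.isWeakGradient η hη)).trans (congrArg _ h4.symm)

/-- A bounded pointwise limit of test functions whose gradients converge boundedly and pointwise
is an element of `H¹₀(Ω)`. -/
theorem exists_H10_of_tendsto {φ : ℕ → Space → ℝ} {f : Space → ℝ} {G : Space → Space} {C : ℝ}
    (hφ : ∀ n, IsTestFunction (φ n)) (hC : ∀ n x, ‖φ n x‖ ≤ C) (hC' : ∀ n x, ‖(∇ (φ n)) x‖ ≤ C)
    (hf : ∀ᵐ x ∂cubeMeasure, Tendsto (fun n => φ n x) atTop (𝓝 (f x)))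
    (hG : ∀ᵐ x ∂cubeMeasure, Tendsto (fun n => (∇ (φ n)) x) atTop (𝓝 (G x))) :
    ∃ u : H10, toL2 u =ᵐ[cubeMeasure] f ∧ grad u =ᵐ[cubeMeasure] G := by
  have hm : ∀ n, AEStronglyMeasurable (φ n) cubeMeasure := fun n => (hφ n).memLp.1
  have hm' : ∀ n, AEStronglyMeasurable (∇ (φ n)) cubeMeasure := fun n => (hφ n).memLp_gradient.1
  have hfL := memLp_two_of_tendsto_ae_of_bounded hm hC hf
  have hGL := memLp_two_of_tendsto_ae_of_bounded hm' hC' hG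
  have hfe := hfL.coeFn_toLp
  have hGe := hGL.coeFn_toLp
  -- The limit must first be an element of `H1`: the weak gradient identity passes to the limit by
  -- dominated convergence.
  have hweak : IsWeakGradient (hfL.toLp f) (hGL.toLp G) := by
    intro η hη
    have h1 : ∫ x in cube, (hfL.toLp f) x • (∇ η) x = ∫ x in cube, f x • (∇ η) x := by
      refine integral_congr_ae ?_
      filter_upwards [hfe] with x hx
      rw [hx]
    have h2 : ∫ x in cube, η x • (hGL.toLp G) x = ∫ x in cube, η x • G x := by
      refine integral_congr_ae ?_
      filter_upwards [hGe] with x hx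
      rw [hx]
    rw [h1, h2]
    have l1 : Tendsto (fun n => ∫ x in cube, φ n x • (∇ η) x) atTop
        (𝓝 (∫ x in cube, f x • (∇ η) x)) := by
      refine tendsto_integral_of_dominated_convergence (fun x => C * ‖(∇ η) x‖)
        (fun n => (hm n).smul hη.memLp_gradient.1)
        ((hη.memLp_gradient.integrable (by norm_num)).norm.const_mul C)
        (fun n => Eventually.of_forall fun x => ?_) ?_
      · rw [norm_smul]
        exact mul_le_mul_of_nonneg_right (hC n x) (norm_nonneg _)
      · filter_upwards [hf] with x hx
        exact hx.smul_const _
    have l2 : Tendsto (fun n => ∫ x in cube, η x • (∇ (φ n)) x) atTop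
        (𝓝 (∫ x in cube, η x • G x)) := by
      refine tendsto_integral_of_dominated_convergence (fun x => ‖η x‖ * C)
        (fun n => hη.memLp.1.smul (hm' n))
        ((hη.memLp.integrable (by norm_num)).norm.mul_const C)
        (fun n => Eventually.of_forall fun x => ?_) ?_
      · rw [norm_smul]
        exact mul_le_mul_of_nonneg_left (hC' n x) (norm_nonneg _)
      · filter_upwards [hG] with x hx
        exact hx.const_smul _
    refine tendsto_nhds_unique l1 (l2.neg.congr fun n => ?_)
    rw [(hφ n).isWeakGradient η hη]
  let u : H1 := ⟨WithLp.toLp 2 (hfL.toLp f, hGL.toLp G), hweak⟩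
  have hu : u ∈ testSubspace.topologicalClosure := by
    choose v hv hv' using fun n => (hφ n).exists_mem_testSubspace
    refine mem_closure_of_tendsto (f := v) (b := atTop) ?_ (Eventually.of_forall hv)
    rw [tendsto_subtype_rng]
    simp only [hv']
    have t1 := (Lp.tendsto_Lp_iff_tendsto_eLpNorm'' φ (fun n => (hφ n).memLp) f hfL).2
      (tendsto_eLpNorm_two_of_tendsto_ae_of_bounded hm hC hf)
    have t2 := (Lp.tendsto_Lp_iff_tendsto_eLpNorm'' (fun n => ∇ (φ n))
      (fun n => (hφ n).memLp_gradient) G hGL).2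
      (tendsto_eLpNorm_two_of_tendsto_ae_of_bounded hm' hC' hG)
    exact ((WithLp.prod_continuous_toLp 2 _ _).tendsto _).comp (t1.prodMk_nhds t2)
  exact ⟨⟨u, hu⟩, hfe, hGe⟩

/-! ### Null sets and norms -/

theorem volume_hyperplane (i : Fin 3) (c : ℝ) : volume {x : Space | x i = c} = 0 := by
  have h : {x : Space | x i = c} = (MeasurableEquiv.toLp 2 (Fin 3 → ℝ)).symm ⁻¹'
      {y | y i = c} := by
    ext x; rfl
  rw [h, (EuclideanSpace.volume_preserving_symm_measurableEquiv_toLp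
    (Fin 3)).measure_preimage_equiv]
  exact Measure.pi_hyperplane (fun _ : Fin 3 => (volume : Measure ℝ)) i c

/-- Applied to the grid coordinates, this discards the cell faces, where hats have kinks. -/
theorem ae_forall_ne (S : Set ℝ) (hS : S.Countable) :
    ∀ᵐ x : Space, ∀ i, x i ∉ S := by
  rw [ae_all_iff]
  intro i
  have : {x : Space | ¬ x i ∉ S} = ⋃ c ∈ S, {x : Space | x i = c} := by
    ext x; simp
  rw [ae_iff, this, measure_biUnion_null_iff hS]
  exact fun c _ => volume_hyperplane i c

/-- The cube has measure one, so a uniform bound is an `L²` bound with the same constant; the factor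
`2` majorizes `√2`. -/
theorem norm_le_of_ae_bound {u : H10} {f : Space → ℝ} {G : Space → Space} {ε : ℝ} (hε : 0 ≤ ε)
    (hf : toL2 u =ᵐ[cubeMeasure] f) (hG : grad u =ᵐ[cubeMeasure] G)
    (hf' : ∀ᵐ x ∂cubeMeasure, ‖f x‖ ≤ ε) (hG' : ∀ᵐ x ∂cubeMeasure, ‖G x‖ ≤ ε) :
    ‖u‖ ≤ 2 * ε := by
  have h1 : ‖toL2 u‖ ≤ ε := by
    have := Lp.norm_le_of_ae_bound (f := toL2 u) hε (by
      filter_upwards [hf, hf'] with x h h'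
      rwa [h])
    simpa [measureUnivNNReal] using this
  have h2 : ‖grad u‖ ≤ ε := by
    have := Lp.norm_le_of_ae_bound (f := grad u) hε (by
      filter_upwards [hG, hG'] with x h h'
      rwa [h])
    simpa [measureUnivNNReal] using this
  refine abs_le_of_sq_le_sq' ?_ (by positivity) |>.2
  rw [norm_sq_eq]
  nlinarith [norm_nonneg (toL2 u), norm_nonneg (grad u)]

/-! ### Smooth approximation of the hat function -/

/-- The hat function on the real line, with support `[-1, 1]`. -/
noncomputable def hat (t : ℝ) : ℝ := max 0 (1 - |t|)

/-- The derivative of the hat function, set to `0` at the kinks. -/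
noncomputable def hatDeriv (t : ℝ) : ℝ :=
  if -1 < t ∧ t < 0 then 1 else if 0 < t ∧ t < 1 then -1 else 0

/-- The truncation of the identity to `[-1/2, 1/2]`. -/
noncomputable def clamp (t : ℝ) : ℝ := max (-(1 / 2)) (min t (1 / 2))

/-- `clamp` is a primitive of the indicator of `[-1/2, 1/2]`, so smoothing this single indicator
smooths the hat. -/
theorem hat_eq_clamp (t : ℝ) : hat t = clamp (t + 1 / 2) - clamp (t - 1 / 2) := by
  unfold hat clamp
  rcases abs_cases t with ⟨h, h'⟩ | ⟨h, h'⟩ <;> rw [h] <;> grind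

theorem hat_nonneg (t : ℝ) : 0 ≤ hat t := le_max_left _ _

theorem hat_le_one (t : ℝ) : hat t ≤ 1 := max_le zero_le_one (by linarith [abs_nonneg t])

theorem abs_hat_le_one (t : ℝ) : |hat t| ≤ 1 := by
  rw [abs_of_nonneg (hat_nonneg t)]; exact hat_le_one t

theorem abs_hatDeriv_le_one (t : ℝ) : |hatDeriv t| ≤ 1 := by
  unfold hatDeriv; split_ifs <;> simp

theorem hat_of_one_le_abs {t : ℝ} (ht : 1 ≤ |t|) : hat t = 0 := max_eq_left (by linarith)

theorem hatDeriv_of_one_le_abs {t : ℝ} (ht : 1 ≤ |t|) : hatDeriv t = 0 := by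
  have : ¬ (-1 < t ∧ t < 0) ∧ ¬ (0 < t ∧ t < 1) := by
    constructor <;> rintro ⟨h1, h2⟩ <;> exact absurd (abs_lt.2 ⟨by linarith, by linarith⟩) ht.not_gt
  rw [hatDeriv, if_neg this.1, if_neg this.2]

theorem hat_of_mem_Icc {t : ℝ} (h0 : 0 ≤ t) (h1 : t ≤ 1) : hat t = 1 - t := by
  rw [hat, abs_of_nonneg h0, max_eq_right (by linarith)]

theorem hat_sub_one {t : ℝ} (h0 : 0 ≤ t) (h1 : t ≤ 1) : hat (t - 1) = t := by
  rw [hat, abs_of_nonpos (by linarith), max_eq_right (by linarith)]; ring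

theorem hatDeriv_of_mem_Ioo {t : ℝ} (h0 : 0 < t) (h1 : t < 1) : hatDeriv t = -1 := by
  rw [hatDeriv, if_neg (by simp [h0.le]), if_pos ⟨h0, h1⟩]

theorem hatDeriv_sub_one {t : ℝ} (h0 : 0 < t) (h1 : t < 1) : hatDeriv (t - 1) = 1 := by
  rw [hatDeriv, if_pos ⟨by linarith, by linarith⟩]

/-- A smooth bump on the line supported in the interior of `[-1/2, 1/2]`. -/
noncomputable def bump (n : ℕ) : ContDiffBump (0 : ℝ) where
  -- Both radii increase to `1/2`; the shift by `3` keeps `rIn` at least `1/6`. Strictness of `rOut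
  -- < 1/2` later keeps the smoothed hat supported inside the open interval `(-1, 1)`.
  rIn := 1 / 2 - 1 / (n + 3)
  rOut := 1 / 2 - 1 / (2 * (n + 3))
  rIn_pos := by
    have : (1 : ℝ) / (n + 3) ≤ 1 / 3 := by
      apply one_div_le_one_div_of_le <;> linarith [(Nat.cast_nonneg n : (0 : ℝ) ≤ n)]
    linarith
  rIn_lt_rOut := by
    have : (1 : ℝ) / (2 * (n + 3)) < 1 / (n + 3) := by
      apply one_div_lt_one_div_of_lt <;> linarith [(Nat.cast_nonneg n : (0 : ℝ) ≤ n)]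
    linarith

theorem bump_rOut_lt (n : ℕ) : (bump n).rOut < 1 / 2 := by
  have : (0 : ℝ) < 1 / (2 * (n + 3)) := by positivity
  simp only [bump]; linarith

theorem tendsto_bump_rIn : Tendsto (fun n => (bump n).rIn) atTop (𝓝 (1 / 2)) := by
  have h : Tendsto (fun n : ℕ => (1 : ℝ) / (n + 3)) atTop (𝓝 0) := by
    have := (tendsto_add_atTop_iff_nat (f := fun n : ℕ => (1 : ℝ) / n) 3).2
      tendsto_one_div_atTop_nhds_zero_nat
    simpa using this
  simpa [bump] using h.const_sub (1 / 2 : ℝ)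

theorem bump_of_half_le_abs (n : ℕ) {t : ℝ} (ht : 1 / 2 ≤ |t|) : bump n t = 0 :=
  (bump n).zero_of_le_dist (by
    rw [Real.dist_eq, sub_zero]; exact (bump_rOut_lt n).le.trans ht)

theorem bump_of_abs_le (n : ℕ) {t : ℝ} (ht : |t| ≤ (bump n).rIn) : bump n t = 1 :=
  (bump n).one_of_mem_closedBall (by simpa [Real.dist_eq] using ht)

theorem tendsto_bump {t : ℝ} (ht : |t| < 1 / 2) :
    Tendsto (fun n => bump n t) atTop (𝓝 1) := by
  refine tendsto_const_nhds.congr' ?_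
  filter_upwards [tendsto_bump_rIn.eventually_const_lt ht] with n hn
  exact (bump_of_abs_le n hn.le).symm

/-- The primitive of `bump n` that vanishes at the origin. -/
noncomputable def bumpPrimitive (n : ℕ) (t : ℝ) : ℝ := ∫ s in 0..t, bump n s

theorem bumpPrimitive_sub (n : ℕ) (s t : ℝ) :
    bumpPrimitive n t - bumpPrimitive n s = ∫ r in s..t, bump n r :=
  intervalIntegral.integral_interval_sub_left ((bump n).continuous.intervalIntegrable _ _)
    ((bump n).continuous.intervalIntegrable _ _)

theorem hasDerivAt_bumpPrimitive (n : ℕ) (t : ℝ) :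
    HasDerivAt (bumpPrimitive n) (bump n t) t :=
  (bump n).continuous.integral_hasStrictDerivAt 0 t |>.hasDerivAt

theorem contDiff_bumpPrimitive (n : ℕ) : ContDiff ℝ ∞ (bumpPrimitive n) := by
  rw [contDiff_infty_iff_deriv]
  refine ⟨fun t => (hasDerivAt_bumpPrimitive n t).differentiableAt, ?_⟩
  rw [show deriv (bumpPrimitive n) = bump n from
    funext fun t => (hasDerivAt_bumpPrimitive n t).deriv]
  exact (bump n).contDiff

theorem abs_bumpPrimitive_sub_le (n : ℕ) (s t : ℝ) :
    |bumpPrimitive n t - bumpPrimitive n s| ≤ |t - s| := by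
  rw [bumpPrimitive_sub]
  have := intervalIntegral.norm_integral_le_of_norm_le_const (a := s) (b := t) (C := 1)
    (f := fun r => bump n r) fun r _ => by
      rw [Real.norm_eq_abs, abs_of_nonneg (bump n).nonneg]; exact (bump n).le_one
  simpa using this

theorem bumpPrimitive_eq_of_rOut_le (n : ℕ) {s t : ℝ} (hs : (bump n).rOut ≤ s)
    (ht : (bump n).rOut ≤ t) : bumpPrimitive n t = bumpPrimitive n s := by
  rw [← sub_eq_zero, bumpPrimitive_sub]
  refine intervalIntegral.integral_zero_ae (Eventually.of_forall fun r hr => ?_)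
  refine (bump n).zero_of_le_dist ?_
  rw [Real.dist_eq, sub_zero]
  exact ((le_min hs ht).trans (Set.uIoc_subset_uIcc hr).1).trans (le_abs_self r)

theorem bumpPrimitive_neg (n : ℕ) (t : ℝ) : bumpPrimitive n (-t) = -bumpPrimitive n t := by
  have := intervalIntegral.integral_comp_neg (a := 0) (b := t) (fun s => bump n s)
  simp only [(bump n).neg, neg_zero] at this
  rw [bumpPrimitive, bumpPrimitive, this, intervalIntegral.integral_symm]

theorem bumpPrimitive_of_abs_le (n : ℕ) {t : ℝ} (ht : |t| ≤ (bump n).rIn) :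
    bumpPrimitive n t = t := by
  rw [bumpPrimitive, intervalIntegral.integral_congr (g := fun _ => (1 : ℝ))]
  · simp
  · intro s hs
    refine bump_of_abs_le n (le_trans ?_ ht)
    simpa using Set.abs_sub_left_of_mem_uIcc hs

/-- The primitive is constant beyond `rOut`, so its value is the one at `1/2`. It is 1-Lipschitz and
fixes `rIn`, hence this value differs from `1/2` by at most `2 * |1/2 - rIn|`. -/
theorem tendsto_bumpPrimitive_of_half_le {t : ℝ} (ht : 1 / 2 ≤ t) :
    Tendsto (fun n => bumpPrimitive n t) atTop (𝓝 (1 / 2)) := by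
  rw [tendsto_iff_dist_tendsto_zero]
  have h : Tendsto (fun n => 2 * |1 / 2 - (bump n).rIn|) atTop (𝓝 0) := by
    simpa using ((tendsto_bump_rIn.const_sub (1 / 2 : ℝ)).abs).const_mul 2
  refine squeeze_zero (fun _ => dist_nonneg) (fun n => ?_) h
  have h1 := abs_bumpPrimitive_sub_le n (bump n).rIn (1 / 2)
  rw [bumpPrimitive_of_abs_le n (abs_of_pos (bump n).rIn_pos).le] at h1
  rw [Real.dist_eq, bumpPrimitive_eq_of_rOut_le n (bump_rOut_lt n).le
    ((bump_rOut_lt n).le.trans ht)]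
  have h2 := abs_sub_le (bumpPrimitive n (1 / 2)) (bump n).rIn (1 / 2)
  rw [abs_sub_comm (bump n).rIn] at h2
  linarith

theorem tendsto_bumpPrimitive (t : ℝ) :
    Tendsto (fun n => bumpPrimitive n t) atTop (𝓝 (clamp t)) := by
  rcases le_or_gt (1 / 2) t with h | h
  · rw [clamp, min_eq_right h, max_eq_right (by norm_num)]
    exact tendsto_bumpPrimitive_of_half_le h
  rcases le_or_gt t (-(1 / 2)) with h' | h'
  · rw [clamp, min_eq_left h.le, max_eq_left h']
    have := (tendsto_bumpPrimitive_of_half_le (le_neg.1 h')).neg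
    simpa only [bumpPrimitive_neg, neg_neg] using this
  · rw [clamp, min_eq_left h.le, max_eq_right h'.le]
    refine tendsto_const_nhds.congr' ?_
    filter_upwards [tendsto_bump_rIn.eventually_const_lt (abs_lt.2 ⟨h', h⟩)] with n hn
    exact (bumpPrimitive_of_abs_le n hn.le).symm

/-- Smooth approximations of the hat function. -/
noncomputable def smoothHat (n : ℕ) (t : ℝ) : ℝ :=
  bumpPrimitive n (t + 1 / 2) - bumpPrimitive n (t - 1 / 2)

theorem contDiff_smoothHat (n : ℕ) : ContDiff ℝ ∞ (smoothHat n) :=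
  ((contDiff_bumpPrimitive n).comp (contDiff_id.add contDiff_const)).sub
    ((contDiff_bumpPrimitive n).comp (contDiff_id.sub contDiff_const))

theorem deriv_smoothHat (n : ℕ) (t : ℝ) :
    deriv (smoothHat n) t = bump n (t + 1 / 2) - bump n (t - 1 / 2) :=
  (((hasDerivAt_bumpPrimitive n _).comp_add_const t (1 / 2)).sub
    ((hasDerivAt_bumpPrimitive n _).comp_sub_const t (1 / 2))).deriv

theorem abs_smoothHat_le_one (n : ℕ) (t : ℝ) : |smoothHat n t| ≤ 1 := by
  have := abs_bumpPrimitive_sub_le n (t - 1 / 2) (t + 1 / 2)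
  rwa [show t + 1 / 2 - (t - 1 / 2) = 1 by ring, abs_one] at this

theorem abs_deriv_smoothHat_le_one (n : ℕ) (t : ℝ) : |deriv (smoothHat n) t| ≤ 1 := by
  rw [deriv_smoothHat]
  exact abs_sub_le_of_nonneg_of_le (bump n).nonneg (bump n).le_one (bump n).nonneg (bump n).le_one

theorem tendsto_smoothHat (t : ℝ) : Tendsto (fun n => smoothHat n t) atTop (𝓝 (hat t)) := by
  rw [hat_eq_clamp]
  exact (tendsto_bumpPrimitive _).sub (tendsto_bumpPrimitive _)

/-- Convergence holds at the kinks too: at `-1`, `0` and `1` both shifted arguments have modulus at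
least `1/2`, where every bump vanishes. This matches the value `0` of `hatDeriv`. -/
theorem tendsto_deriv_smoothHat (t : ℝ) :
    Tendsto (fun n => deriv (smoothHat n) t) atTop (𝓝 (hatDeriv t)) := by
  simp only [deriv_smoothHat]
  have hout : ∀ {s : ℝ}, 1 / 2 ≤ |s| → Tendsto (fun n => bump n s) atTop (𝓝 0) := fun hs =>
    tendsto_const_nhds.congr fun n => (bump_of_half_le_abs n hs).symm
  unfold hatDeriv
  split_ifs with h1 h2
  · simpa using (tendsto_bump (t := t + 1 / 2) (abs_lt.2 ⟨by linarith, by linarith⟩)).sub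
      (hout (s := t - 1 / 2) (le_abs.2 (Or.inr (by linarith))))
  · simpa using (hout (s := t + 1 / 2) (le_abs.2 (Or.inl (by linarith)))).sub
      (tendsto_bump (t := t - 1 / 2) (abs_lt.2 ⟨by linarith, by linarith⟩))
  · have h3 : 1 / 2 ≤ |t + 1 / 2| ∧ 1 / 2 ≤ |t - 1 / 2| := by
      constructor <;> rw [le_abs] <;> by_contra! hc <;> grind
    simpa using (hout h3.1).sub (hout h3.2)

theorem tsupport_smoothHat_subset (n : ℕ) : tsupport (smoothHat n) ⊆ Set.Ioo (-1) 1 := by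
  have hr := bump_rOut_lt n
  have hsub : tsupport (smoothHat n)
      ⊆ Set.Icc (-((bump n).rOut + 1 / 2)) ((bump n).rOut + 1 / 2) := by
    refine closure_minimal (fun t ht => ?_) isClosed_Icc
    by_contra hc
    rw [Set.mem_Icc, not_and_or, not_le, not_le] at hc
    refine ht ?_
    rcases hc with hc | hc
    -- Oddness of the primitive reduces the left tail to the right one.
    · rw [smoothHat, ← neg_neg (t + 1 / 2), ← neg_neg (t - 1 / 2), bumpPrimitive_neg,
        bumpPrimitive_neg n (-(t - 1 / 2)), sub_eq_zero, neg_inj]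
      exact bumpPrimitive_eq_of_rOut_le n (by linarith) (by linarith)
    · exact sub_eq_zero.2 (bumpPrimitive_eq_of_rOut_le n (by linarith) (by linarith))
  exact hsub.trans fun t ht => ⟨by linarith [ht.1], by linarith [ht.2]⟩

/-! ### Nodal sums of tensor products -/

/-- The tensor product `∏ᵢ Fᵢ(xᵢ / h - jᵢ)` attached to the node `h j`. -/
noncomputable def tensor (F : Fin 3 → ℝ → ℝ) (h : ℝ) (j : Fin 3 → ℕ) (x : Space) : ℝ :=
  ∏ i, F i (x i / h - j i)

/-- The nodes `j` with `0 ≤ jᵢ ≤ N`. -/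
def nodes (N : ℕ) : Finset (Fin 3 → ℕ) := Fintype.piFinset fun _ => Finset.range (N + 1)

/-- The combination of the tensor products of `g` with nodal coefficients `c`. -/
noncomputable def nodalSum (c : (Fin 3 → ℕ) → ℝ) (N : ℕ) (h : ℝ) (g : ℝ → ℝ) (x : Space) : ℝ :=
  ∑ j ∈ nodes N, c j * tensor (fun _ => g) h j x

/-- The gradient of `nodalSum c N h g`, if `g'` is the derivative of `g`. -/
noncomputable def nodalGrad (c : (Fin 3 → ℕ) → ℝ) (N : ℕ) (h : ℝ) (g g' : ℝ → ℝ) (x : Space) :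
    Space :=
  WithLp.toLp 2 fun l => ∑ j ∈ nodes N, c j * (tensor (Function.update (fun _ => g) l g') h j x / h)

theorem abs_tensor_le_one {F : Fin 3 → ℝ → ℝ} (hF : ∀ i t, |F i t| ≤ 1) (h : ℝ) (j : Fin 3 → ℕ)
    (x : Space) : |tensor F h j x| ≤ 1 := by
  rw [tensor, Finset.abs_prod]
  exact Finset.prod_le_one (fun i _ => abs_nonneg _) fun i _ => hF i _

theorem abs_update_le_one {g g' : ℝ → ℝ} (hg : ∀ t, |g t| ≤ 1) (hg' : ∀ t, |g' t| ≤ 1)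
    (l i : Fin 3) (t : ℝ) : |Function.update (fun _ => g) l g' i t| ≤ 1 := by
  rcases eq_or_ne i l with rfl | hi
  · simpa using hg' t
  · simpa [hi] using hg t

/-- The constant `2` majorizes `√3`. -/
theorem norm_le_two_mul_of_abs_le {v : Space} {ε : ℝ} (hv : ∀ i, |v i| ≤ ε) : ‖v‖ ≤ 2 * ε := by
  have hε : 0 ≤ ε := (abs_nonneg _).trans (hv 0)
  refine abs_le_of_sq_le_sq' ?_ (by positivity) |>.2
  rw [EuclideanSpace.norm_sq_eq, Fin.sum_univ_three]
  have h : ∀ i, ‖v i‖ ^ 2 ≤ ε ^ 2 := fun i => by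
    rw [Real.norm_eq_abs]; exact pow_le_pow_left₀ (abs_nonneg _) (hv i) 2
  nlinarith [h 0, h 1, h 2]

theorem hasFDerivAt_tensor {g : ℝ → ℝ} (hg : Differentiable ℝ g) (h : ℝ) (j : Fin 3 → ℕ)
    (x : Space) :
    HasFDerivAt (tensor (fun _ => g) h j)
      (∑ i, (∏ m ∈ Finset.univ.erase i, g (x m / h - j m)) •
        ((deriv g (x i / h - j i) / h) • (EuclideanSpace.proj i : StrongDual ℝ Space))) x := by
  refine HasFDerivAt.finsetProd (g := fun i (y : Space) => g (y i / h - j i)) fun i _ => ?_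
  have h1 : HasDerivAt (fun t : ℝ => g (t / h - j i)) (deriv g (x i / h - j i) * (1 / h)) (x i) :=
    (hg _).hasDerivAt.comp (x i) (((hasDerivAt_id (x i)).div_const h).sub_const _)
  have h2 := h1.comp_hasFDerivAt x (EuclideanSpace.proj (𝕜 := ℝ) i).hasFDerivAt
  rw [← div_eq_mul_one_div] at h2
  exact h2

theorem fderiv_tensor_single {g : ℝ → ℝ} (hg : Differentiable ℝ g) (h : ℝ) (j : Fin 3 → ℕ)
    (x : Space) (l : Fin 3) :
    fderiv ℝ (tensor (fun _ => g) h j) x (EuclideanSpace.single l 1)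
      = tensor (Function.update (fun _ => g) l (deriv g)) h j x / h := by
  rw [(hasFDerivAt_tensor hg h j x).fderiv, sum_apply,
    Finset.sum_eq_single l]
  · have h1 : ∏ m ∈ Finset.univ.erase l, Function.update (fun _ => g) l (deriv g) m (x m / h - j m)
        = ∏ m ∈ Finset.univ.erase l, g (x m / h - j m) :=
      Finset.prod_congr rfl fun m hm => by
        rw [Function.update_of_ne (Finset.ne_of_mem_erase hm)]
    rw [tensor, ← Finset.prod_erase_mul _ _ (Finset.mem_univ l), h1]
    simp
    ring
  · intro i _ hi
    simp [hi]
  · simp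

theorem gradient_nodalSum {g : ℝ → ℝ} (hg : Differentiable ℝ g) (c : (Fin 3 → ℕ) → ℝ) (N : ℕ)
    (h : ℝ) : ∇ (nodalSum c N h g) = nodalGrad c N h g (deriv g) := by
  funext x
  ext l
  have h1 : ((∇ (nodalSum c N h g)) x) l
      = fderiv ℝ (nodalSum c N h g) x (EuclideanSpace.single l 1) := by
    rw [← inner_gradient_eq_fderiv, EuclideanSpace.inner_single_left]
    simp
  have h2 : HasFDerivAt (nodalSum c N h g)
      (∑ j ∈ nodes N, c j • fderiv ℝ (tensor (fun _ => g) h j) x) x :=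
    HasFDerivAt.fun_sum fun j _ =>
      ((hasFDerivAt_tensor hg h j x).differentiableAt.hasFDerivAt).const_smul (c j)
  rw [h1, h2.fderiv, sum_apply]
  simp only [smul_apply, fderiv_tensor_single hg, smul_eq_mul, nodalGrad]

/-- This bound and the next are crude in the mesh, but they do not depend on the smoothing index,
which is all that bounded convergence on a fixed mesh requires. -/
theorem abs_nodalSum_le {g : ℝ → ℝ} (hg : ∀ t, |g t| ≤ 1) (c : (Fin 3 → ℕ) → ℝ) (N : ℕ)
    (h : ℝ) (x : Space) : |nodalSum c N h g x| ≤ ∑ j ∈ nodes N, |c j| := by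
  refine (Finset.abs_sum_le_sum_abs _ _).trans (Finset.sum_le_sum fun j _ => ?_)
  rw [abs_mul]
  exact mul_le_of_le_one_right (abs_nonneg _) (abs_tensor_le_one (fun _ => hg) h j x)

theorem norm_nodalGrad_le {g g' : ℝ → ℝ} (hg : ∀ t, |g t| ≤ 1) (hg' : ∀ t, |g' t| ≤ 1)
    (c : (Fin 3 → ℕ) → ℝ) (N : ℕ) {h : ℝ} (hh : 0 < h) (x : Space) :
    ‖nodalGrad c N h g g' x‖ ≤ 2 * ∑ j ∈ nodes N, |c j| / h := by
  refine norm_le_two_mul_of_abs_le fun l => ?_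
  refine (Finset.abs_sum_le_sum_abs _ _).trans (Finset.sum_le_sum fun j _ => ?_)
  rw [abs_mul, abs_div, abs_of_pos hh, ← mul_div_assoc]
  gcongr
  exact mul_le_of_le_one_right (abs_nonneg _)
    (abs_tensor_le_one (abs_update_le_one hg hg' l) h j x)

theorem tendsto_tensor {F : ℕ → Fin 3 → ℝ → ℝ} {F' : Fin 3 → ℝ → ℝ}
    (hF : ∀ i t, Tendsto (fun n => F n i t) atTop (𝓝 (F' i t))) (h : ℝ) (j : Fin 3 → ℕ)
    (x : Space) : Tendsto (fun n => tensor (F n) h j x) atTop (𝓝 (tensor F' h j x)) :=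
  tendsto_finsetProd _ fun i _ => hF i _

theorem tendsto_nodalSum (c : (Fin 3 → ℕ) → ℝ) (N : ℕ) (h : ℝ) (x : Space) :
    Tendsto (fun n => nodalSum c N h (smoothHat n) x) atTop (𝓝 (nodalSum c N h hat x)) :=
  tendsto_finsetSum _ fun j _ =>
    (tendsto_tensor (fun _ => tendsto_smoothHat) h j x).const_mul (c j)

theorem tendsto_nodalGrad (c : (Fin 3 → ℕ) → ℝ) (N : ℕ) (h : ℝ) (x : Space) :
    Tendsto (fun n => nodalGrad c N h (smoothHat n) (deriv (smoothHat n)) x) atTop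
      (𝓝 (nodalGrad c N h hat hatDeriv x)) := by
  refine ((PiLp.continuous_toLp 2 _).tendsto _).comp (tendsto_pi_nhds.2 fun l =>
    tendsto_finsetSum _ fun j _ =>
      Tendsto.const_mul _ (Tendsto.div_const (tendsto_tensor ?_ h j x) h))
  intro i t
  rcases eq_or_ne i l with rfl | hi
  · simpa using tendsto_deriv_smoothHat t
  · simpa [hi] using tendsto_smoothHat t

theorem isCompact_cube : IsCompact cube := by
  refine Metric.isCompact_of_isClosed_isBounded isClosed_cube
    ((Metric.isBounded_closedBall (x := (0 : Space)) (r := 2 * 1)).subset fun x hx => ?_)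
  rw [mem_closedBall_zero_iff]
  exact norm_le_two_mul_of_abs_le fun i => abs_le.2 ⟨by linarith [(hx i).1], (hx i).2⟩

theorem isTestFunction_of_smooth {φ : Space → ℝ} (h : ContDiff ℝ ∞ φ)
    (h' : tsupport φ ⊆ openCube) : IsTestFunction φ :=
  ⟨h, isCompact_cube.of_isClosed_subset (isClosed_tsupport _) (h'.trans openCube_subset_cube), h'⟩

/-- For an interior node the support lies in the product of the intervals `((j i - 1) * h, (j i + 1)
* h)`, each contained in `(0, 1)`. -/
theorem isTestFunction_tensor {g : ℝ → ℝ} (hg : ContDiff ℝ ∞ g)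
    (hsupp : tsupport g ⊆ Set.Ioo (-1) 1) {N : ℕ} {h : ℝ} (hh : 0 < h) (hN : (N : ℝ) * h = 1)
    {j : Fin 3 → ℕ} (hj : ∀ i, 1 ≤ j i ∧ j i + 1 ≤ N) :
    IsTestFunction (tensor (fun _ => g) h j) := by
  refine isTestFunction_of_smooth (contDiff_prod fun i _ => hg.comp (by fun_prop)) ?_
  have hsub : tsupport (tensor (fun _ => g) h j)
      ⊆ ⋂ i, {x : Space | x i / h - j i ∈ tsupport g} := by
    refine closure_minimal (fun x hx => ?_) (isClosed_iInter fun i =>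
      (isClosed_tsupport g).preimage (by fun_prop))
    simp only [Set.mem_iInter]
    exact fun i => subset_tsupport g fun h0 => hx (Finset.prod_eq_zero (Finset.mem_univ i) h0)
  intro x hx i
  obtain ⟨h1, h2⟩ := hsupp (Set.mem_iInter.1 (hsub hx) i)
  have h3 : (1 : ℝ) ≤ j i := by exact_mod_cast (hj i).1
  have h4 : (j i : ℝ) + 1 ≤ N := by exact_mod_cast (hj i).2
  constructor
  · have : 0 < x i / h := by linarith
    exact (div_pos_iff_of_pos_right hh).1 this
  · have : x i / h < N := by linarith
    rwa [div_lt_iff₀ hh, hN] at this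

theorem IsTestFunction.sum {ι : Type*} (s : Finset ι) {φ : ι → Space → ℝ}
    (hφ : ∀ j ∈ s, IsTestFunction (φ j)) : IsTestFunction fun x => ∑ j ∈ s, φ j x := by
  classical
  induction s using Finset.induction_on with
  | empty => simp only [Finset.sum_empty]; exact IsTestFunction.zero
  | insert a s ha ih =>
    simp only [Finset.sum_insert ha]
    exact (hφ a (Finset.mem_insert_self a s)).add
      (ih fun j hj => hφ j (Finset.mem_insert_of_mem hj))

theorem isTestFunction_nodalSum {g : ℝ → ℝ} (hg : ContDiff ℝ ∞ g)
    (hsupp : tsupport g ⊆ Set.Ioo (-1) 1) {N : ℕ} {h : ℝ} (hh : 0 < h) (hN : (N : ℝ) * h = 1)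
    {c : (Fin 3 → ℕ) → ℝ} (hc : ∀ j, c j ≠ 0 → ∀ i, 1 ≤ j i ∧ j i + 1 ≤ N) :
    IsTestFunction (nodalSum c N h g) := by
  refine IsTestFunction.sum _ fun j _ => ?_
  rcases eq_or_ne (c j) 0 with h0 | h0
  · simp only [h0, zero_mul]; exact IsTestFunction.zero
  · exact (isTestFunction_tensor hg hsupp hh hN (hc j h0)).smul (c j)

/-- The piecewise trilinear function with given values at the interior nodes lies in
`H¹₀(Ω)`. -/
theorem exists_H10_nodalSum {N : ℕ} {h : ℝ} (hh : 0 < h) (hN : (N : ℝ) * h = 1)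
    {c : (Fin 3 → ℕ) → ℝ} (hc : ∀ j, c j ≠ 0 → ∀ i, 1 ≤ j i ∧ j i + 1 ≤ N) :
    ∃ u : H10, toL2 u =ᵐ[cubeMeasure] nodalSum c N h hat ∧
      grad u =ᵐ[cubeMeasure] nodalGrad c N h hat hatDeriv := by
  have hgrad : ∀ n, ∇ (nodalSum c N h (smoothHat n))
      = nodalGrad c N h (smoothHat n) (deriv (smoothHat n)) := fun n =>
    gradient_nodalSum ((contDiff_smoothHat n).differentiable (by simp)) c N h
  refine exists_H10_of_tendsto (φ := fun n => nodalSum c N h (smoothHat n))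
    (C := max (∑ j ∈ nodes N, |c j|) (2 * ∑ j ∈ nodes N, |c j| / h))
    (fun n => isTestFunction_nodalSum (contDiff_smoothHat n) (tsupport_smoothHat_subset n) hh hN hc)
    (fun n x => le_max_of_le_left (abs_nodalSum_le (abs_smoothHat_le_one n) c N h x))
    (fun n x => le_max_of_le_right ?_) (Eventually.of_forall (tendsto_nodalSum c N h))
    (Eventually.of_forall fun x => ?_)
  · rw [hgrad]
    exact norm_nodalGrad_le (abs_smoothHat_le_one n) (abs_deriv_smoothHat_le_one n) c N hh x
  · simp only [hgrad]
    exact tendsto_nodalGrad c N h x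

/-! ### Restriction to a cell -/

/-- The nodes at the vertices of the cell with lower corner `h k`. -/
def vertices (k : Fin 3 → ℕ) : Finset (Fin 3 → ℕ) := Fintype.piFinset fun i => {k i, k i + 1}

/-- Unless `j i` is `k i` or `k i + 1` for all `i`, some argument `x i / h - j i` has modulus at
least one. A general `F` covers values and partial derivatives alike. -/
theorem sum_nodes_eq_sum_vertices {N : ℕ} {h : ℝ} {k : Fin 3 → ℕ} (hk : ∀ i, k i + 1 ≤ N)
    {F : Fin 3 → ℝ → ℝ} (hF : ∀ i t, 1 ≤ |t| → F i t = 0) (c : (Fin 3 → ℕ) → ℝ) {x : Space}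
    (hx : ∀ i, x i / h - k i ∈ Set.Ioo (0 : ℝ) 1) :
    ∑ j ∈ nodes N, c j * tensor F h j x = ∑ j ∈ vertices k, c j * tensor F h j x := by
  refine (Finset.sum_subset (fun j hj => ?_) fun j _ hj => ?_).symm
  · simp only [vertices, nodes, Fintype.mem_piFinset, Finset.mem_insert, Finset.mem_singleton,
      Finset.mem_range] at hj ⊢
    intro i
    have := hk i
    rcases hj i with h | h <;> omega
  · simp only [vertices, Fintype.mem_piFinset, Finset.mem_insert, Finset.mem_singleton,
      not_forall, not_or] at hj
    obtain ⟨i, h1, h2⟩ := hj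
    rw [tensor, Finset.prod_eq_zero (Finset.mem_univ i), mul_zero]
    refine hF i _ ?_
    obtain ⟨h3, h4⟩ := hx i
    rw [le_abs]
    rcases lt_or_ge (j i) (k i) with hlt | hge
    · left
      have : (j i : ℝ) + 1 ≤ k i := by exact_mod_cast hlt
      linarith
    · right
      have : (k i : ℝ) + 2 ≤ j i := by exact_mod_cast (by omega : k i + 2 ≤ j i)
      linarith

theorem update_hat_eq_zero (l i : Fin 3) (t : ℝ) (ht : 1 ≤ |t|) :
    Function.update (fun _ => hat) l hatDeriv i t = 0 := by
  rcases eq_or_ne i l with rfl | hi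
  · simpa using hatDeriv_of_one_le_abs ht
  · simpa [hi] using hat_of_one_le_abs ht

/-- Distributivity: the eight-term identities below become products of two-term identities on the
line. -/
theorem sum_vertices_prod (k : Fin 3 → ℕ) (f : Fin 3 → ℕ → ℝ) :
    ∑ j ∈ vertices k, ∏ i, f i (j i) = ∏ i, (f i (k i) + f i (k i + 1)) := by
  rw [vertices, ← Finset.prod_univ_sum]
  exact Finset.prod_congr rfl fun i _ => Finset.sum_pair (by omega)

section Cell

variable {h : ℝ} {k : Fin 3 → ℕ} {x : Space}

theorem hat_add_hat {s : ℝ} {m : ℕ} (hs : s - m ∈ Set.Ioo (0 : ℝ) 1) :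
    hat (s - m) + hat (s - (m + 1 : ℕ)) = 1 := by
  have : s - ((m + 1 : ℕ) : ℝ) = s - m - 1 := by push_cast; ring
  rw [this, hat_of_mem_Icc hs.1.le hs.2.le, hat_sub_one hs.1.le hs.2.le]
  ring

theorem hatDeriv_vertices {s : ℝ} {m : ℕ} (hs : s - m ∈ Set.Ioo (0 : ℝ) 1) :
    hatDeriv (s - m) = -1 ∧ hatDeriv (s - (m + 1 : ℕ)) = 1 := by
  have : s - ((m + 1 : ℕ) : ℝ) = s - m - 1 := by push_cast; ring
  rw [this]
  exact ⟨hatDeriv_of_mem_Ioo hs.1 hs.2, hatDeriv_sub_one hs.1 hs.2⟩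

theorem sum_vertices_tensor_hat (hx : ∀ i, x i / h - k i ∈ Set.Ioo (0 : ℝ) 1) :
    ∑ j ∈ vertices k, tensor (fun _ => hat) h j x = 1 := by
  simp only [tensor]
  rw [sum_vertices_prod k fun i m => hat (x i / h - m)]
  exact Finset.prod_eq_one fun i _ => hat_add_hat (hx i)

theorem sum_vertices_tensor_update (hx : ∀ i, x i / h - k i ∈ Set.Ioo (0 : ℝ) 1) (l : Fin 3) :
    ∑ j ∈ vertices k, tensor (Function.update (fun _ => hat) l hatDeriv) h j x = 0 := by
  simp only [tensor]
  rw [sum_vertices_prod k fun i m =>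
    Function.update (fun _ => hat) l hatDeriv i (x i / h - m)]
  refine Finset.prod_eq_zero (Finset.mem_univ l) ?_
  obtain ⟨h1, h2⟩ := hatDeriv_vertices (hx l)
  simp only [Function.update_self, h1, h2]
  ring

/-- Interpolation reproduces the gradient of each coordinate function. If `m ≠ l`, the factor in
direction `l` is `-1 + 1 = 0`; if `m = l`, it is the difference quotient of the coordinate over one
cell, which is `1`, and the other factors are sums of two hats. -/
theorem sum_vertices_coord_mul_tensor_update (hh : 0 < h)
    (hx : ∀ i, x i / h - k i ∈ Set.Ioo (0 : ℝ) 1) (l m : Fin 3) :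
    ∑ j ∈ vertices k, ((j m : ℝ) * h - x m)
        * (tensor (Function.update (fun _ => hat) l hatDeriv) h j x / h)
      = if m = l then 1 else 0 := by
  -- The coordinate and the `1 / h` are absorbed into the factor of index `m`, so that
  -- `sum_vertices_prod` applies.
  have key : ∀ j : Fin 3 → ℕ, ((j m : ℝ) * h - x m)
        * (tensor (Function.update (fun _ => hat) l hatDeriv) h j x / h)
      = ∏ i, ((if i = m then (((j i : ℝ) * h - x i) / h) else 1)
          * Function.update (fun _ => hat) l hatDeriv i (x i / h - j i)) := by
    intro j
    rw [Finset.prod_mul_distrib, Finset.prod_ite_eq' Finset.univ m, if_pos (Finset.mem_univ m),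
      tensor]
    ring
  simp only [key]
  rw [sum_vertices_prod k fun i n => ((if i = m then (((n : ℝ) * h - x i) / h) else 1)
          * Function.update (fun _ => hat) l hatDeriv i (x i / h - n))]
  obtain ⟨h1, h2⟩ := hatDeriv_vertices (hx l)
  split_ifs with hml
  · subst hml
    refine Finset.prod_eq_one fun i _ => ?_
    rcases eq_or_ne i m with rfl | hi
    · simp only [if_true, Function.update_self, h1, h2]
      push_cast
      field_simp
      ring
    · simp only [hi, if_false, Function.update_of_ne hi, one_mul]
      exact hat_add_hat (hx i)
  · refine Finset.prod_eq_zero (Finset.mem_univ l) ?_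
    simp only [Ne.symm hml, if_false, Function.update_self, h1, h2]
    ring

end Cell

/-! ### Interpolation error on a cell -/

/-- The node `h j`. -/
noncomputable def node (h : ℝ) (j : Fin 3 → ℕ) : Space := WithLp.toLp 2 fun i => (j i : ℝ) * h

theorem node_apply (h : ℝ) (j : Fin 3 → ℕ) (i : Fin 3) : node h j i = j i * h := rfl

theorem card_vertices (k : Fin 3 → ℕ) : (vertices k).card = 8 := by
  rw [vertices, Fintype.card_piFinset, Fin.prod_univ_three]
  simp

section Cell

variable {h : ℝ} {k : Fin 3 → ℕ} {x : Space}

theorem norm_node_sub_le (hh : 0 < h) (hx : ∀ i, x i / h - k i ∈ Set.Ioo (0 : ℝ) 1)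
    {j : Fin 3 → ℕ} (hj : j ∈ vertices k) : ‖node h j - x‖ ≤ 2 * h := by
  refine norm_le_two_mul_of_abs_le fun i => ?_
  rw [PiLp.sub_apply, node_apply]
  obtain ⟨h1, h2⟩ := hx i
  rw [sub_pos, lt_div_iff₀ hh] at h1
  rw [sub_lt_iff_lt_add, div_lt_iff₀ hh] at h2
  simp only [vertices, Fintype.mem_piFinset, Finset.mem_insert, Finset.mem_singleton] at hj
  rw [abs_le]
  rcases hj i with h3 | h3 <;> rw [h3] <;> push_cast <;> constructor <;> linarith

/-- Inside a cell the interpolant is a convex combination of the vertex values of `ψ`. -/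
theorem abs_nodalSum_sub_le {N : ℕ} (hh : 0 < h) (hk : ∀ i, k i + 1 ≤ N)
    (hx : ∀ i, x i / h - k i ∈ Set.Ioo (0 : ℝ) 1) {ψ : Space → ℝ} {η : ℝ}
    (hψ : ∀ y, ‖y - x‖ ≤ 2 * h → |ψ y - ψ x| ≤ η) :
    |nodalSum (fun j => ψ (node h j)) N h hat x - ψ x| ≤ η := by
  have h1 := sum_vertices_tensor_hat hx
  rw [nodalSum, sum_nodes_eq_sum_vertices hk (fun _ _ => hat_of_one_le_abs) _ hx]
  have h2 : ∑ j ∈ vertices k, ψ (node h j) * tensor (fun _ => hat) h j x - ψ x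
      = ∑ j ∈ vertices k, (ψ (node h j) - ψ x) * tensor (fun _ => hat) h j x := by
    simp only [sub_mul, Finset.sum_sub_distrib, ← Finset.mul_sum, h1, mul_one]
  rw [h2]
  calc |∑ j ∈ vertices k, (ψ (node h j) - ψ x) * tensor (fun _ => hat) h j x|
      ≤ ∑ j ∈ vertices k, η * tensor (fun _ => hat) h j x := by
        refine (Finset.abs_sum_le_sum_abs _ _).trans (Finset.sum_le_sum fun j hj => ?_)
        have hpos : 0 ≤ tensor (fun _ => hat) h j x := Finset.prod_nonneg fun i _ => hat_nonneg _
        rw [abs_mul, abs_of_nonneg hpos]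
        exact mul_le_mul_of_nonneg_right (hψ _ (norm_node_sub_le hh hx hj)) hpos
    _ = η := by rw [← Finset.mul_sum, h1, mul_one]

theorem fderiv_eq_sum_gradient (ψ : Space → ℝ) (x v : Space) :
    fderiv ℝ ψ x v = ∑ m, v m * ((∇ ψ) x) m := by
  rw [← inner_gradient_eq_fderiv, PiLp.inner_apply]
  simp [mul_comm]

/-- The weights `w` sum to zero and reproduce linear functions, so the error is a sum of first-order
Taylor remainders at `x`, weighted by `w`. A remainder is at most `η * (2 * h)` and a weight at most
`1 / h`, so `h` cancels. Eight vertices give `16 * η` per component, and passing to the norm doubles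
this. -/
theorem norm_nodalGrad_sub_le {N : ℕ} (hh : 0 < h) (hk : ∀ i, k i + 1 ≤ N)
    (hx : ∀ i, x i / h - k i ∈ Set.Ioo (0 : ℝ) 1) {ψ : Space → ℝ} (hd : Differentiable ℝ ψ)
    {η : ℝ} (hη : 0 ≤ η) (hψ : ∀ y, ‖y - x‖ ≤ 2 * h → ‖fderiv ℝ ψ y - fderiv ℝ ψ x‖ ≤ η) :
    ‖nodalGrad (fun j => ψ (node h j)) N h hat hatDeriv x - (∇ ψ) x‖ ≤ 32 * η := by
  rw [show 32 * η = 2 * (16 * η) by ring]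
  refine norm_le_two_mul_of_abs_le fun l => ?_
  let w : (Fin 3 → ℕ) → ℝ := fun j => tensor (Function.update (fun _ => hat) l hatDeriv) h j x / h
  have hw : ∑ j ∈ vertices k, w j = 0 := by
    simp only [w, ← Finset.sum_div, sum_vertices_tensor_update hx l, zero_div]
  have hwL : ∑ j ∈ vertices k, fderiv ℝ ψ x (node h j - x) * w j = ((∇ ψ) x) l := by
    simp only [fderiv_eq_sum_gradient, Finset.sum_mul]
    rw [Finset.sum_comm]
    have : ∀ m, ∑ j ∈ vertices k, (node h j - x) m * ((∇ ψ) x) m * w j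
        = (if m = l then 1 else 0) * ((∇ ψ) x) m := fun m => by
      rw [← sum_vertices_coord_mul_tensor_update hh hx l m, Finset.sum_mul]
      refine Finset.sum_congr rfl fun j _ => ?_
      rw [PiLp.sub_apply, node_apply]
      ring
    simp only [this, ite_mul, one_mul, zero_mul, Finset.sum_ite_eq', Finset.mem_univ, if_true]
  have hsum : nodalGrad (fun j => ψ (node h j)) N h hat hatDeriv x l
      = ∑ j ∈ vertices k, ψ (node h j) * w j := by
    have := sum_nodes_eq_sum_vertices hk (update_hat_eq_zero l) (fun j => ψ (node h j)) hx
    simp only [nodalGrad, w, ← mul_div_assoc, ← Finset.sum_div, this]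
  have hdiff : (nodalGrad (fun j => ψ (node h j)) N h hat hatDeriv x - (∇ ψ) x) l
      = ∑ j ∈ vertices k, (ψ (node h j) - ψ x - fderiv ℝ ψ x (node h j - x)) * w j := by
    rw [PiLp.sub_apply, hsum]
    simp only [sub_mul, Finset.sum_sub_distrib, ← Finset.mul_sum, hw, mul_zero, sub_zero]
    rw [hwL]
  rw [hdiff]
  calc |∑ j ∈ vertices k, (ψ (node h j) - ψ x - fderiv ℝ ψ x (node h j - x)) * w j|
      ≤ ∑ j ∈ vertices k, (η * (2 * h)) * (1 / h) := by
        refine (Finset.abs_sum_le_sum_abs _ _).trans (Finset.sum_le_sum fun j hj => ?_)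
        rw [abs_mul]
        have hj' := norm_node_sub_le hh hx hj
        refine mul_le_mul ?_ ?_ (abs_nonneg _) (by positivity)
        · refine le_trans ?_ (mul_le_mul_of_nonneg_left hj' hη)
          -- Mean value inequality for `ψ` minus its linearization at `x`, on a ball containing the
          -- vertices.
          refine Convex.norm_image_sub_le_of_norm_fderiv_le' (s := Metric.closedBall x (2 * h))
            (fun y _ => hd y) (fun y hy => hψ y (by rwa [← dist_eq_norm])) (convex_closedBall _ _)
            (Metric.mem_closedBall_self (by positivity))
            (by rwa [Metric.mem_closedBall, dist_eq_norm])
        · rw [abs_div, abs_of_pos hh]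
          gcongr
          exact abs_tensor_le_one (abs_update_le_one abs_hat_le_one abs_hatDeriv_le_one l) h j x
    _ = 16 * η := by
        rw [Finset.sum_const, card_vertices]
        field_simp
        ring

end Cell

/-! ### The nodal interpolant in the finite element space -/

theorem countable_grid (h : ℝ) : (Set.range fun m : ℕ => (m : ℝ) * h).Countable :=
  Set.countable_range _

/-- Almost every point of the cube lies in the interior of a cell. -/
theorem ae_exists_cell {N : ℕ} {h : ℝ} (hh : 0 < h) (hN : (N : ℝ) * h = 1) :
    ∀ᵐ x ∂cubeMeasure, ∃ k : Fin 3 → ℕ, (∀ i, k i + 1 ≤ N) ∧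
      ∀ i, x i / h - k i ∈ Set.Ioo (0 : ℝ) 1 := by
  filter_upwards [ae_restrict_mem measurableSet_cube,
    ae_restrict_of_ae (ae_forall_ne _ (countable_grid h))] with x hx hxn
  -- Off the grid the floor is strict. This puts `x` in an open cell and also keeps the index below
  -- `N` when `x i` is close to `1`.
  have hlt : ∀ i, (⌊x i / h⌋₊ : ℝ) < x i / h := fun i =>
    lt_of_le_of_ne (Nat.floor_le (div_nonneg (hx i).1 hh.le)) fun he =>
      hxn i ⟨⌊x i / h⌋₊, by simp only [he, div_mul_cancel₀ _ hh.ne']⟩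
  refine ⟨fun i => ⌊x i / h⌋₊, fun i => ?_, fun i => ⟨sub_pos.2 (hlt i), ?_⟩⟩
  · have h1 : x i / h ≤ N := by rw [div_le_iff₀ hh, hN]; exact (hx i).2
    exact_mod_cast (hlt i).trans_le h1
  · rw [sub_lt_iff_lt_add']
    exact Nat.lt_floor_add_one _

theorem prod_affine_mem_Q1 (a b : Fin 3 → ℝ) :
    (fun y : Space => ∏ i, (a i + b i * y i)) ∈ Q1 := by
  have hsub : ∀ f ∈ ({fun _ => 1, fun x => x 0, fun x => x 1, fun x => x 2,
    fun x => x 0 * x 1, fun x => x 0 * x 2, fun x => x 1 * x 2,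
    fun x => x 0 * x 1 * x 2} : Set (Space → ℝ)), f ∈ Q1 := fun f hf => Submodule.subset_span hf
  have heq : (fun y : Space => ∏ i, (a i + b i * y i))
      = (a 0 * a 1 * a 2) • (fun _ => 1) + (b 0 * a 1 * a 2) • (fun x : Space => x 0)
        + (a 0 * b 1 * a 2) • (fun x : Space => x 1) + (a 0 * a 1 * b 2) • (fun x : Space => x 2)
        + (b 0 * b 1 * a 2) • (fun x : Space => x 0 * x 1)
        + (b 0 * a 1 * b 2) • (fun x : Space => x 0 * x 2)
        + (a 0 * b 1 * b 2) • (fun x : Space => x 1 * x 2)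
        + (b 0 * b 1 * b 2) • (fun x : Space => x 0 * x 1 * x 2) := by
    funext y
    simp only [Fin.prod_univ_three, Pi.add_apply, Pi.smul_apply, smul_eq_mul]
    ring
  rw [heq]
  repeat' first
    | apply Submodule.add_mem
    | exact Submodule.smul_mem _ _ (hsub _ (by simp))

theorem mem_femSpace_of_ae_eq_nodalSum {N : ℕ} {h : ℝ} (hh : 0 < h) (hN : (N : ℝ) * h = 1)
    {c : (Fin 3 → ℕ) → ℝ} {u : H10} (hu : toL2 u =ᵐ[cubeMeasure] nodalSum c N h hat) :
    u ∈ femSpace h := by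
  intro p hp
  -- Cells are numbered from `1` and nodes from `0`.
  let k : Fin 3 → ℕ := fun i => p i - 1
  have hkp : ∀ i, k i + 1 = p i := fun i => Nat.sub_add_cancel (hp i).1
  have hkp' : ∀ i, (p i : ℝ) = k i + 1 := fun i => by exact_mod_cast (hkp i).symm
  have hk : ∀ i, k i + 1 ≤ N := fun i => by
    rw [hkp]
    have : (p i : ℝ) * h ≤ N * h := by rw [hN]; exact (hp i).2
    exact_mod_cast le_of_mul_le_mul_right this hh
  -- In the local coordinate `y i = x i - k i * h`, the hat of the lower node is `1 - y i / h` and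
  -- that of the upper node is `y i / h`.
  refine ⟨∑ j ∈ vertices k, c j • fun y => ∏ i, ((if j i = k i then 1 else 0)
      + (if j i = k i then -(1 / h) else 1 / h) * y i), ?_, ?_⟩
  · exact Submodule.sum_mem _ fun j _ => Submodule.smul_mem _ _ (prod_affine_mem_Q1 _ _)
  have hcell : MeasurableSet (cell h p) := by
    have : cell h p = ⋂ i, {x : Space | x i ∈ Set.Icc (((p i : ℝ) - 1) * h) ((p i : ℝ) * h)} := by
      ext x; simp [cell]
    rw [this]
    exact MeasurableSet.iInter fun i =>
      (isClosed_Icc.preimage (f := fun x : Space => x i) (by fun_prop)).measurableSet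
  filter_upwards [ae_restrict_mem hcell, ae_restrict_of_ae (ae_imp_of_ae_restrict hu),
    ae_restrict_of_ae (ae_forall_ne _ (countable_grid h))] with x hx hxu hxn hxc
  have hxk : ∀ i, x i / h - k i ∈ Set.Ioo (0 : ℝ) 1 := fun i => by
    obtain ⟨h1, h2⟩ := hx i
    have h3 : x i ≠ p i * h := fun he => hxn i ⟨p i, he.symm⟩
    have h4 : x i ≠ (p i - 1) * h := fun he => hxn i ⟨k i, by
      simp only [he, hkp']; ring⟩
    have h5 := lt_of_le_of_ne h1 h4.symm
    have h6 := lt_of_le_of_ne h2 h3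
    rw [← lt_div_iff₀ hh] at h5
    rw [← div_lt_iff₀ hh] at h6
    have := hkp' i
    constructor <;> linarith
  rw [hxu hxc, nodalSum, sum_nodes_eq_sum_vertices hk (fun _ _ => hat_of_one_le_abs) _ hxk]
  simp only [Finset.sum_apply, Pi.smul_apply, smul_eq_mul]
  refine Finset.sum_congr rfl fun j hj => ?_
  congr 1
  refine Finset.prod_congr rfl fun i _ => ?_
  have hc : (x - corner h p) i = x i - k i * h := by
    rw [PiLp.sub_apply]
    simp only [corner, hkp']
    ring
  simp only [vertices, Fintype.mem_piFinset, Finset.mem_insert, Finset.mem_singleton] at hj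
  obtain ⟨h1, h2⟩ := hxk i
  rw [hc]
  beta_reduce
  rcases hj i with h3 | h3
  · rw [if_pos h3, if_pos h3, h3, hat_of_mem_Icc h1.le h2.le]
    field_simp
    ring
  · have h4 : j i ≠ k i := by omega
    rw [if_neg h4, if_neg h4, h3]
    have : x i / h - ((k i + 1 : ℕ) : ℝ) = x i / h - k i - 1 := by push_cast; ring
    rw [this, hat_sub_one h1.le h2.le]
    field_simp
    ring

/-- A test function vanishes at boundary nodes, so its interpolant uses interior nodes only, as
`exists_H10_nodalSum` demands. -/
theorem IsTestFunction.node_ne_zero {ψ : Space → ℝ} (hψ : IsTestFunction ψ) {N : ℕ} {h : ℝ}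
    (hh : 0 < h) (hN : (N : ℝ) * h = 1) (j : Fin 3 → ℕ) (hj : ψ (node h j) ≠ 0) (i : Fin 3) :
    1 ≤ j i ∧ j i + 1 ≤ N := by
  obtain ⟨h1, h2⟩ := hψ.tsupport_subset (subset_tsupport ψ hj) i
  rw [node_apply] at h1 h2
  have h3 : (0 : ℝ) < j i := pos_of_mul_pos_left h1 hh.le
  rw [← hN] at h2
  have h4 : (j i : ℝ) < N := lt_of_mul_lt_mul_right h2 hh.le
  exact ⟨by exact_mod_cast h3, by exact_mod_cast h4⟩

/-- Test functions are approximated by their nodal interpolants. -/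
theorem IsTestFunction.exists_femSpace_near {ψ : Space → ℝ} (hψ : IsTestFunction ψ) {ε : ℝ}
    (hε : 0 < ε) : ∃ δ > 0, ∀ h ∈ meshSizes, h < δ → ∀ u : H10,
      toL2 u =ᵐ[cubeMeasure] ψ → grad u =ᵐ[cubeMeasure] ∇ ψ →
        ∃ χ ∈ femSpace h, ‖u - χ‖ ≤ ε := by
  -- The gradient estimate costs a factor `32` and `norm_le_of_ae_bound` a factor `2`.
  have hη : 0 < ε / 64 := by positivity
  obtain ⟨δ₁, hδ₁, H1⟩ := Metric.uniformContinuous_iff.1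
    (hψ.hasCompactSupport.uniformContinuous_of_continuous hψ.smooth.continuous) (ε / 64) hη
  obtain ⟨δ₂, hδ₂, H2⟩ := Metric.uniformContinuous_iff.1
    ((hψ.hasCompactSupport.fderiv ℝ).uniformContinuous_of_continuous
      (hψ.smooth.continuous_fderiv (by simp))) (ε / 64) hη
  -- Halved because the vertices of a cell are within `2 * h` of its points.
  refine ⟨min δ₁ δ₂ / 2, by positivity, fun h ⟨hh, _, N, hN⟩ hlt u hu hu' => ?_⟩
  have hlt1 : 2 * h < δ₁ := by linarith [min_le_left δ₁ δ₂]
  have hlt2 : 2 * h < δ₂ := by linarith [min_le_right δ₁ δ₂]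
  obtain ⟨χ, hχ, hχ'⟩ := exists_H10_nodalSum hh hN (hψ.node_ne_zero hh hN)
  refine ⟨χ, mem_femSpace_of_ae_eq_nodalSum hh hN hχ, ?_⟩
  refine (norm_sub_rev u χ).trans_le ?_
  have e1 : toL2 (χ - u) =ᵐ[cubeMeasure]
      fun x => nodalSum (fun j => ψ (node h j)) N h hat x - ψ x :=
    (Lp.coeFn_sub (toL2 χ) (toL2 u)).trans (hχ.sub hu)
  have e2 : grad (χ - u) =ᵐ[cubeMeasure]
      fun x => nodalGrad (fun j => ψ (node h j)) N h hat hatDeriv x - (∇ ψ) x :=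
    (Lp.coeFn_sub (grad χ) (grad u)).trans (hχ'.sub hu')
  rw [show ε = 2 * (32 * (ε / 64)) by ring]
  refine norm_le_of_ae_bound (by positivity) e1 e2 ?_ ?_
  · filter_upwards [ae_exists_cell hh hN] with x ⟨k, hk, hx⟩
    have := abs_nodalSum_sub_le (ψ := ψ) hh hk hx (η := ε / 64) fun y hy =>
      (H1 (by rw [dist_eq_norm]; exact hy.trans_lt hlt1)).le
    rw [Real.norm_eq_abs]
    linarith
  · filter_upwards [ae_exists_cell hh hN] with x ⟨k, hk, hx⟩
    exact norm_nodalGrad_sub_le hh hk hx (hψ.smooth.differentiable (by simp)) hη.le fun y hy => by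
      rw [← dist_eq_norm]
      exact (H2 (by rw [dist_eq_norm]; exact hy.trans_lt hlt2)).le

/-- The finite element spaces become dense in `H¹₀(Ω)` as the mesh is refined. -/
theorem exists_femSpace_near (φ : H10) {ε : ℝ} (hε : 0 < ε) :
    ∃ δ > 0, ∀ h ∈ meshSizes, h < δ → ∃ χ ∈ femSpace h, ‖φ - χ‖ < ε := by
  obtain ⟨v, ⟨ψ, hψ, h1, h2⟩, hv⟩ := Metric.mem_closure_iff.1 φ.2 (ε / 2) (half_pos hε)
  obtain ⟨δ, hδ, H⟩ := hψ.exists_femSpace_near (ε := ε / 4) (by positivity)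
  let u : H10 := ⟨v, testSubspace.le_topologicalClosure ⟨ψ, hψ, h1, h2⟩⟩
  refine ⟨δ, hδ, fun h hh hlt => ?_⟩
  obtain ⟨χ, hχ, hχu⟩ := H h hh hlt u h1 h2
  refine ⟨χ, hχ, ?_⟩
  have h3 : ‖φ - u‖ < ε / 2 := (dist_eq_norm φ u).symm.trans_lt hv
  calc ‖φ - χ‖ ≤ ‖φ - u‖ + ‖u - χ‖ := norm_sub_le_norm_sub_add_norm_sub _ _ _
    _ < ε := by linarith

theorem tendsto_iInf_femSpace (β : ℝ) (φ : H10) :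
    Tendsto (fun h => β⁻¹ * ⨅ χ : femSpace h, ‖φ - χ.1‖) (𝓝[meshSizes] 0) (𝓝 0) := by
  suffices h : Tendsto (fun h => ⨅ χ : femSpace h, ‖φ - χ.1‖) (𝓝[meshSizes] 0) (𝓝 0) by
    simpa only [mul_zero] using h.const_mul β⁻¹
  refine Metric.tendsto_nhdsWithin_nhds.2 fun ε hε => ?_
  obtain ⟨δ, hδ, H⟩ := exists_femSpace_near φ hε
  refine ⟨δ, hδ, fun h hh hlt => ?_⟩
  rw [Real.dist_eq, sub_zero, abs_of_pos hh.1] at hlt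
  obtain ⟨χ, hχ, hlt'⟩ := H h hh hlt
  have h0 : 0 ≤ ⨅ χ : femSpace h, ‖φ - χ.1‖ := Real.iInf_nonneg fun _ => norm_nonneg _
  rw [Real.dist_eq, sub_zero, abs_of_nonneg h0]
  -- A real infimum is below its members only when the family is bounded below, here by `0`.
  exact (ciInf_le ⟨0, by rintro _ ⟨χ, rfl⟩; exact norm_nonneg _⟩ (⟨χ, hχ⟩ : femSpace h)).trans_lt
    hlt'

/-! ### Inf-sup conditions from coercivity -/

/-- The supremum is tested with `ψ` itself, which is admissible in any subspace containing it; hence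
one statement serves `H10`, as `⊤`, and the discrete spaces. -/
theorem iSup_pos_of_coercive {F : H10 → H10 → ℝ} {c : ℝ} (hc : 0 < c)
    (hF : ∀ φ, c * ‖φ‖ ^ 2 ≤ F φ φ) {V : Submodule ℝ H10} {ψ : H10} (hψV : ψ ∈ V) (hψ : ψ ≠ 0) :
    0 < ⨆ φ : V, ENNReal.ofReal |F φ.1 ψ| := by
  have h1 : 0 < F ψ ψ := (mul_pos hc (pow_pos (norm_pos_iff.2 hψ) 2)).trans_le (hF ψ)
  refine (ENNReal.ofReal_pos.2 (abs_pos_of_pos h1)).trans_le ?_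
  exact le_iSup (fun φ : V => ENNReal.ofReal |F φ.1 ψ|) ⟨ψ, hψV⟩

theorem le_abs_of_coercive {F : H10 → H10 → ℝ} {c : ℝ} (hF : ∀ φ, c * ‖φ‖ ^ 2 ≤ F φ φ) {φ : H10}
    (hφ : ‖φ‖ = 1) : ENNReal.ofReal c ≤ ENNReal.ofReal |F φ φ| := by
  refine ENNReal.ofReal_le_ofReal (le_trans ?_ (le_abs_self _))
  simpa [hφ] using hF φ

end NeutronDiffusion

open NeutronDiffusion in
theorem mainTheorem10
    (D Sa nuSf : NeutronDiffusion.Space → ℝ)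
    (hD : NeutronDiffusion.IsPiecewiseConstant D)
    (hSa : NeutronDiffusion.IsPiecewiseConstant Sa)
    (hnuSf : NeutronDiffusion.IsPiecewiseConstant nuSf)
    (hD_pos : ∀ x ∈ NeutronDiffusion.cube, 0 < D x)
    (hSa_pos : ∀ x ∈ NeutronDiffusion.cube, 0 < Sa x)
    (hnuSf_nonneg : ∀ x ∈ NeutronDiffusion.cube, 0 ≤ nuSf x) :
    ∃ Dmin Samin : ℝ,
      IsLeast (D '' NeutronDiffusion.cube) Dmin ∧
      IsLeast (Sa '' NeutronDiffusion.cube) Samin ∧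
      NeutronDiffusion.BabuskaOsbornWith
        (NeutronDiffusion.formA D Sa) (NeutronDiffusion.formB nuSf)
        NeutronDiffusion.meshSizes NeutronDiffusion.femSpace
        (fun _ => min Dmin Samin) := by
  obtain ⟨d, hd⟩ := hD.exists_isLeast
  obtain ⟨s, hs⟩ := hSa.exists_isLeast
  have hd0 : 0 < d := by
    obtain ⟨x, hx, rfl⟩ := hd.1
    exact hD_pos x hx
  have hs0 : 0 < s := by
    obtain ⟨x, hx, rfl⟩ := hs.1
    exact hSa_pos x hx
  have hpos : 0 < min d s := lt_min hd0 hs0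
  have hcoer : ∀ φ, min d s * ‖φ‖ ^ 2 ≤ formA D Sa φ φ :=
    le_formA_self hD hSa (fun x hx => (min_le_left _ _).trans (hd.2 ⟨x, hx, rfl⟩))
      fun x hx => (min_le_right _ _).trans (hs.2 ⟨x, hx, rfl⟩)
  refine ⟨d, s, hd, hs, ?_⟩
  exact
    { bilinear_A := isBilinear_formA hD hSa
      bounded_A := formA_bounded hD hSa hD_pos hSa_pos
      infSup_one := ⟨min d s, hpos, le_iInf fun φ => (le_abs_of_coercive hcoer φ.2).trans
        (le_iSup (fun ψ : {ψ : H10 // ‖ψ‖ = 1} => ENNReal.ofReal |formA D Sa φ.1 ψ.1|) φ)⟩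
      infSup_two := fun ψ hψ =>
        (iSup_pos_of_coercive hpos hcoer (V := ⊤) Submodule.mem_top hψ).trans_le
          (iSup_le fun φ => le_iSup (fun φ : H10 => ENNReal.ofReal |formA D Sa φ ψ|) φ.1)
      bilinear_B := isBilinear_formB hnuSf
      bounded_B := formB_bounded hnuSf hnuSf_nonneg
      beta_pos := fun _ _ => hpos
      discrete_infSup_one := fun h _ => le_iInf fun φ => (le_abs_of_coercive hcoer φ.2.2).trans
        (le_iSup (fun ψ : {ψ : H10 // ψ ∈ femSpace h ∧ ‖ψ‖ = 1} =>
          ENNReal.ofReal |formA D Sa φ.1 ψ.1|) φ)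
      discrete_infSup_two := fun _ _ _ hψV hψ => iSup_pos_of_coercive hpos hcoer hψV hψ
      approximation := tendsto_iInf_femSpace _ }
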